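/- Let $\mathbb{F}$ be a field of characteristic $0$ and let $K$ be a finite group. For a finite group $G$ let $\mathbb{F}B(G)=\mathbb{F}\otimes_{\mathbb Z}B(G)$, where $B(G)$ is the Grothendieck group of finite $G$-sets, and let $\mathbb{F}B_K$ be the Green biset functor $G\mapsto \mathbb{F}B(G\times K)$ (the Burnside functor shifted by $K$): a finite $(H,G)$-biset $U$ acts by $\mathbb{F}B(U\times K)$, where $K$ acts on both sides of the second factor by multiplication, and the product $\mathbb{F}B_K(G)\times\mathbb{F}B_K(H)\to\mathbb{F}B_K(G\times H)$ is the cartesian product followed by restriction along $(g,h,k)\mapsto(g,k,h,k)$. An $\mathbb{F}B_K$-module is a biset functor $M$ over $\mathbb{F}$ with associative, bifunctorial and unital products $\mathbb{F}B_K(G)\times M(H)\to M(G\times H)$; an ideal of $\mathbb{F}B_K$ is an $\mathbb{F}B_K$-submodule of $\mathbb{F}B_K$. Let $\mathsf{grp}_{\Downarrow K}$ be the category whose objects are the pairs $(L,\varphi)$ with $L$ a finite group and $\varphi:L\to K$ a homomorphism, a morphism $(L,\varphi)\to(L',\varphi')$ being a homomorphism $f:L\to L'$ such that $i\circ\varphi=\varphi'\circ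 f$ for some inner automorphism $i$ of $K$; write $(L,\varphi)\twoheadrightarrow(L',\varphi')$ if there is a surjective such $f$. For a normal subgroup $N$ of $L$ put $m_{L,N}=\frac1{|L|}\sum_{X\le L,\;XN=L}|X|\,\mu(X,L)$, with $\mu$ the Möbius function of the poset of subgroups of $L$. The pair $(L,\varphi)$ is a $B_K$-group if $m_{L,N}=0$ for every non-trivial normal subgroup $N$ of $L$ contained in $\ker\varphi$. For a subgroup $X$ of a finite group $G$ let $e_X^{G}=\frac{1}{|N_G(X)|}\sum_{Y\le X}|Y|\,\mu(Y,X)\,[G/Y]\in\mathbb{F}B(G)$. Let $\mathsf{e}_{L,\varphi}$ be the ideal of $\mathbb{F}B_K$ generated by $e_{L_\varphi}^{L\times K}\in\mathbb{F}B_K(L)$, where $L_\varphi=\{(l,\varphi(l))\mid l\in L\}$. For a $B_K$-group $(L,\varphi)$ let $\mathsf{e}^0_{L,\varphi}$ be the sum of the ideals $\mathsf{e}_{M,\psi}$ over all $B_K$-groups $(M,\psi)$ with $(M,\psi)\twoheadrightarrow(L,\varphi)$ and $(M,\psi)\not\cong(L,\varphi)$, and let $S_{L,\varphi}=\mathsf{e}_{L,\varphi}/\mathsf{e}^0_{L,\varphi}$.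 Then: 1. For every $B_K$-group $(L,\varphi)$, one has $\mathsf{e}^0_{L,\varphi}\subseteq\mathsf{e}_{L,\varphi}$, and $S_{L,\varphi}$ is a simple $\mathbb{F}B_K$-module. 2. If $(L,\varphi)$ and $(M,\psi)$ are $B_K$-groups, then $S_{L,\varphi}$ and $S_{M,\psi}$ are isomorphic as $\mathbb{F}B_K$-modules if and only if $(L,\varphi)$ and $(M,\psi)$ are isomorphic in $\mathsf{grp}_{\Downarrow K}$. 3. The simple subquotients of $\mathbb{F}B_K$ are parametrized by the isomorphism classes of $B_K$-groups: if $I'\subseteq I$ are ideals of $\mathbb{F}B_K$ such that $I/I'$ is a simple $\mathbb{F}B_K$-module, then there is a $B_K$-group $(L,\varphi)$, unique up to isomorphism in $\mathsf{grp}_{\Downarrow K}$, such that $I/I'\cong S_{L,\varphi}$. -/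

import Mathlib

universe u v w

namespace RelBGroup

open MulOpposite

noncomputable section

/-! ## Finite sets with a group action, and finite bisets -/

/-- A finite (left) `G`-set. -/
structure GSet (G : Type u) [Group G] where
  carrier : Type u
  [action : MulAction G carrier]
  [finite : Finite carrier]

attribute [instance] GSet.action GSet.finite

/-- A finite `(H, G)`-biset: a finite set with a left action of `H` and a right action of `G`
(i.e. a left action of the opposite group) that commute. -/
structure Biset (H G : Type u) [Group H] [Group G] where
  carrier : Type u
  [left : MulAction H carrier]
  [right : MulAction Gᵐᵒᵖ carrier]
  [comm : SMulCommClass H Gᵐᵒᵖ carrier]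
  [finite : Finite carrier]

attribute [instance] Biset.left Biset.right Biset.comm Biset.finite

namespace GSet

variable {G H : Type u} [Group G] [Group H]

/-- Isomorphism of `G`-sets. -/
def IsIso (X Y : GSet G) : Prop :=
  ∃ e : X.carrier ≃ Y.carrier, ∀ (g : G) (x : X.carrier), e (g • x) = g • e x

/-- Disjoint union of `G`-sets. -/
def sum (X Y : GSet G) : GSet G := ⟨X.carrier ⊕ Y.carrier⟩

/-- The cartesian product of a `G`-set and an `H`-set, as a `(G × H)`-set. -/
def prod (X : GSet G) (Y : GSet H) : GSet (G × H) where
  carrier := X.carrier × Y.carrier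
  action :=
    { smul := fun g p => (g.1 • p.1, g.2 • p.2)
      one_smul := fun p => Prod.ext (one_smul G p.1) (one_smul H p.2)
      mul_smul := fun g g' p => Prod.ext (mul_smul g.1 g'.1 p.1) (mul_smul g.2 g'.2 p.2) }

/-- The `G`-set obtained from an `H`-set along a homomorphism `G → H`. -/
def res (f : G →* H) (X : GSet H) : GSet G where
  carrier := X.carrier
  action := MulAction.compHom X.carrier f

/-- The transitive `G`-set `G / X`. -/
def coset [Finite G] (X : Subgroup G) : GSet G := ⟨G ⧸ X⟩

/-- The one-point `G`-set. -/
def point (G : Type u) [Group G] : GSet G where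
  carrier := PUnit
  action :=
    { smul := fun _ p => p
      one_smul := fun _ => rfl
      mul_smul := fun _ _ _ => rfl }

theorem IsIso.of_bijective {X Y : GSet G} (f : X.carrier → Y.carrier)
    (hf : Function.Bijective f) (h : ∀ (g : G) x, f (g • x) = g • f x) : IsIso X Y :=
  ⟨Equiv.ofBijective f hf, h⟩

end GSet

namespace Biset

variable {G H J : Type u} [Group G] [Group H] [Group J]

/-- Isomorphism of `(H, G)`-bisets. -/
def IsIso (U V : Biset H G) : Prop :=
  ∃ e : U.carrier ≃ V.carrier, (∀ (h : H) u, e (h • u) = h • e u) ∧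
    ∀ (g : G) u, e (op g • u) = op g • e u

/-- Disjoint union of bisets. -/
def sum (U V : Biset H G) : Biset H G := ⟨U.carrier ⊕ V.carrier⟩

/-- The `(H, G)`-biset `H`, with `h • x • g = h * x * f g`, attached to an isomorphism `f`. -/
def iso [Finite H] (f : G ≃* H) : Biset H G :=
  letI : MulAction Gᵐᵒᵖ H :=
    { smul := fun g x => x * f g.unop
      one_smul := fun x => by change x * f 1 = x; simp
      mul_smul := fun g g' x => by
        change x * f (g'.unop * g.unop) = x * f g'.unop * f g.unop
        simp [mul_assoc] }
  { carrier := H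
    comm := ⟨fun h g x => (mul_assoc h x (f g.unop)).symm⟩ }

/-- The product of an `(H, G)`-biset and an `(H', G')`-biset,
as an `(H × H', G × G')`-biset. -/
def prod {G' H' : Type u} [Group G'] [Group H'] (U : Biset H G) (V : Biset H' G') :
    Biset (H × H') (G × G') :=
  letI : MulAction (H × H') (U.carrier × V.carrier) :=
    { smul := fun h p => (h.1 • p.1, h.2 • p.2)
      one_smul := fun p => Prod.ext (one_smul H p.1) (one_smul H' p.2)
      mul_smul := fun h h' p => Prod.ext (mul_smul h.1 h'.1 p.1) (mul_smul h.2 h'.2 p.2) }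
  letI : MulAction (G × G')ᵐᵒᵖ (U.carrier × V.carrier) :=
    { smul := fun g p => (op g.unop.1 • p.1, op g.unop.2 • p.2)
      one_smul := fun p => Prod.ext (one_smul Gᵐᵒᵖ p.1) (one_smul G'ᵐᵒᵖ p.2)
      mul_smul := fun g g' p =>
        Prod.ext (mul_smul (op g.unop.1) (op g'.unop.1) p.1)
          (mul_smul (op g.unop.2) (op g'.unop.2) p.2) }
  { carrier := U.carrier × V.carrier
    comm := ⟨fun h g p =>
      Prod.ext (smul_comm h.1 (op g.unop.1) p.1) (smul_comm h.2 (op g.unop.2) p.2)⟩ }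

/-- For a set `X` with a left action of `G`, the relation on `U × X` whose quotient
is `U ×_G X`: it identifies `(u, x)` with `(u g, g⁻¹ x)`. -/
def tensorSetoid (U : Biset H G) (X : Type u) [MulAction G X] : Setoid (U.carrier × X) where
  r p q := ∃ g : G, q = (op g • p.1, g⁻¹ • p.2)
  iseqv :=
    { refl := fun p => ⟨1, by simp⟩
      symm := by
        rintro p q ⟨g, rfl⟩
        refine ⟨g⁻¹, ?_⟩
        simp [← mul_smul]
      trans := by
        rintro p q r ⟨g, rfl⟩ ⟨g', rfl⟩
        refine ⟨g * g', ?_⟩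
        simp [mul_smul] }

/-- `U ×_G X`. -/
def Tensor (U : Biset H G) (X : Type u) [MulAction G X] : Type u :=
  Quotient (U.tensorSetoid X)

/-- The class of `(u, x)` in `U ×_G X`. -/
def tmk (U : Biset H G) {X : Type u} [MulAction G X] (u : U.carrier) (x : X) : U.Tensor X :=
  Quotient.mk (U.tensorSetoid X) (u, x)

section

variable (U : Biset H G) {X : Type u} [MulAction G X]

instance [Finite X] : Finite (U.Tensor X) := by
  unfold Tensor
  infer_instance

theorem tmk_eq_iff {u u' : U.carrier} {x x' : X} :
    U.tmk u x = U.tmk u' x' ↔ ∃ g : G, u' = op g • u ∧ x' = g⁻¹ • x := by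
  have h : U.tmk u x = U.tmk u' x' ↔ ∃ g : G, (u', x') = (op g • u, g⁻¹ • x) :=
    Quotient.eq (r := U.tensorSetoid X)
  simpa using h

theorem tmk_op_smul (g : G) (u : U.carrier) (x : X) :
    U.tmk (op g • u) x = U.tmk u (g • x) := by
  symm
  rw [tmk_eq_iff]
  exact ⟨g, rfl, by simp⟩

theorem tmk_inj (u : U.carrier) (x : X) (u' : U.carrier) (x' : X)
    (h : U.tmk u x = U.tmk u' x') : ∃ g : G, op g • u = u' ∧ x = g • x' := by
  obtain ⟨g, rfl, rfl⟩ := U.tmk_eq_iff.1 h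
  exact ⟨g, rfl, by simp⟩

theorem tmk_eq {u u' : U.carrier} {x x' : X} (g : G) (h : op g • u = u') (h' : x = g • x') :
    U.tmk u x = U.tmk u' x' := by
  subst h h'
  exact (U.tmk_op_smul g u x').symm

theorem exists_tmk (t : U.Tensor X) : ∃ u x, U.tmk u x = t := by
  obtain ⟨⟨u, x⟩, h⟩ := Quotient.exists_rep t
  exact ⟨u, x, h⟩

/-- Functions out of `U ×_G X`. -/
def tlift {β : Type*} (f : U.carrier → X → β)
    (hf : ∀ (g : G) u x, f (op g • u) x = f u (g • x)) : U.Tensor X → β :=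
  Quotient.lift (fun p : U.carrier × X => f p.1 p.2) (by
    rintro ⟨u, x⟩ ⟨u', x'⟩ ⟨g, hg⟩
    obtain ⟨rfl, rfl⟩ := Prod.mk.inj hg
    simp [hf])

theorem tlift_tmk {β : Type*} (f : U.carrier → X → β)
    (hf : ∀ (g : G) u x, f (op g • u) x = f u (g • x)) (u : U.carrier) (x : X) :
    U.tlift f hf (U.tmk u x) = f u x := rfl

/-- The left action of `H` on `U ×_G X`. -/
instance tensorAction : MulAction H (U.Tensor X) where
  smul h := U.tlift (fun u x => U.tmk (h • u) x) (fun g u x => by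
    rw [smul_comm, tmk_op_smul])
  one_smul t := by
    obtain ⟨u, x, rfl⟩ := U.exists_tmk t
    change U.tmk ((1 : H) • u) x = _
    rw [one_smul]
  mul_smul h h' t := by
    obtain ⟨u, x, rfl⟩ := U.exists_tmk t
    change U.tmk ((h * h') • u) x = U.tmk (h • h' • u) x
    rw [mul_smul]

theorem smul_tmk (h : H) (u : U.carrier) (x : X) : h • U.tmk u x = U.tmk (h • u) x := rfl

end

/-- The `H`-set `U ×_G X`. -/
def app (U : Biset H G) (X : GSet G) : GSet H := ⟨U.Tensor X.carrier⟩

/-- The composition `V ×_H U` of a `(J, H)`-biset and an `(H, G)`-biset. -/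
def comp (V : Biset J H) (U : Biset H G) : Biset J G :=
  letI : MulAction Gᵐᵒᵖ (V.Tensor U.carrier) :=
    { smul := fun g => V.tlift (fun v u => V.tmk v (g • u)) (fun h v u => by
        rw [tmk_op_smul, smul_comm])
      one_smul := fun t => by
        obtain ⟨v, u, rfl⟩ := V.exists_tmk t
        change V.tmk v ((1 : Gᵐᵒᵖ) • u) = _
        rw [one_smul]
      mul_smul := fun g g' t => by
        obtain ⟨v, u, rfl⟩ := V.exists_tmk t
        change V.tmk v ((g * g') • u) = V.tmk v (g • g' • u)
        rw [mul_smul] }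
  { carrier := V.Tensor U.carrier
    comm := ⟨fun j g t => by
      obtain ⟨v, u, rfl⟩ := V.exists_tmk t
      change V.tmk (j • v) (g • u) = V.tmk (j • v) (g • u)
      rfl⟩ }

/-- The `(K, K)`-biset `K` by left and right multiplication. -/
abbrev ident (K : Type u) [Group K] [Finite K] : Biset K K := iso (MulEquiv.refl K)

/-- The `(H × K, G × K)`-biset `U × K`, where `K` acts on both sides by multiplication on the
second component. -/
def shift (K : Type u) [Group K] [Finite K] (U : Biset H G) : Biset (H × K) (G × K) :=
  U.prod (ident K)

theorem IsIso.of_bijective {U V : Biset H G} (f : U.carrier → V.carrier)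
    (hf : Function.Bijective f) (h1 : ∀ (h : H) u, f (h • u) = h • f u)
    (h2 : ∀ (g : G) u, f (op g • u) = op g • f u) : IsIso U V :=
  ⟨Equiv.ofBijective f hf, h1, h2⟩

end Biset

/-! ## The Burnside functor with coefficients in `F` -/

section Burnside

variable (F : Type v) [Field F]

/-- The defining relations of `F ⊗ B(G)`: `[X] = [Y]` whenever `X ≅ Y`,
and `[X ⊔ Y] = [X] + [Y]`. -/
def burnsideRel (G : Type u) [Group G] : Submodule F (GSet.{u} G →₀ F) :=
  Submodule.span F
    ({r | ∃ X Y : GSet G, X.IsIso Y ∧ r = Finsupp.single X 1 - Finsupp.single Y 1} ∪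
     {r | ∃ X Y : GSet G,
        r = Finsupp.single (X.sum Y) 1 - (Finsupp.single X 1 + Finsupp.single Y 1)})

/-- `F ⊗ B(G)`, where `B(G)` is the Grothendieck group of finite `G`-sets for disjoint union,
presented by generators and relations. -/
abbrev FB (G : Type u) [Group G] : Type (max (u + 1) v) :=
  (GSet.{u} G →₀ F) ⧸ burnsideRel F G

namespace FB

variable {G H J : Type u} [Group G] [Group H] [Group J]

/-- The class `[X]` of a finite `G`-set. -/
def of (X : GSet G) : FB F G := Submodule.Quotient.mk (Finsupp.single X 1)

variable {F}

theorem of_eq_of_isIso {X Y : GSet G} (h : X.IsIso Y) : of F X = of F Y :=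
  (Submodule.Quotient.eq _).2 (Submodule.subset_span (Or.inl ⟨X, Y, h, rfl⟩))

theorem of_sum (X Y : GSet G) : of F (X.sum Y) = of F X + of F Y := by
  unfold of
  rw [← Submodule.Quotient.mk_add]
  exact (Submodule.Quotient.eq _).2 (Submodule.subset_span (Or.inr ⟨X, Y, rfl⟩))

/-- Linear maps out of `F ⊗ B(G)`. -/
def lift {M : Type*} [AddCommGroup M] [Module F M] (f : GSet G → M)
    (hiso : ∀ X Y : GSet G, X.IsIso Y → f X = f Y)
    (hsum : ∀ X Y : GSet G, f (X.sum Y) = f X + f Y) : FB F G →ₗ[F] M :=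
  Submodule.liftQ _ (Finsupp.linearCombination F f) (by
    unfold burnsideRel
    rw [Submodule.span_le]
    rintro r (⟨X, Y, h, rfl⟩ | ⟨X, Y, rfl⟩)
    · simp [hiso X Y h]
    · simp [hsum X Y])

theorem lift_of {M : Type*} [AddCommGroup M] [Module F M] (f : GSet G → M)
    (hiso : ∀ X Y : GSet G, X.IsIso Y → f X = f Y)
    (hsum : ∀ X Y : GSet G, f (X.sum Y) = f X + f Y) (X : GSet G) :
    lift f hiso hsum (of F X) = f X := by
  unfold lift of
  rw [← Submodule.mkQ_apply, ← LinearMap.comp_apply, Submodule.liftQ_mkQ]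
  simp

theorem hom_ext {M : Type*} [AddCommGroup M] [Module F M] {f g : FB F G →ₗ[F] M}
    (h : ∀ X, f (of F X) = g (of F X)) : f = g := by
  apply Submodule.linearMap_qext
  apply Finsupp.lhom_ext'
  intro X
  apply LinearMap.ext_ring
  exact h X

/-- The map `FB(U) : FB(G) → FB(H)`, `[X] ↦ [U ×_G X]`, for an `(H, G)`-biset `U`. -/
def map (U : Biset H G) : FB F G →ₗ[F] FB F H :=
  lift (fun X => of F (U.app X))
    (fun X Y ⟨e, he⟩ => by
      apply of_eq_of_isIso
      refine GSet.IsIso.of_bijective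
        (U.tlift (fun u x => U.tmk u (e x)) (fun g u x => by rw [he, U.tmk_op_smul]))
        ⟨?_, ?_⟩ ?_
      · intro s t hst
        obtain ⟨u, x, rfl⟩ := U.exists_tmk s
        obtain ⟨u', x', rfl⟩ := U.exists_tmk t
        obtain ⟨g, h, h'⟩ := U.tmk_inj u (e x) u' (e x') hst
        rw [← he] at h'
        exact U.tmk_eq g h (e.injective h')
      · intro t
        obtain ⟨u, y, rfl⟩ := U.exists_tmk t
        exact ⟨U.tmk u (e.symm y), congrArg (U.tmk u) (e.apply_symm_apply y)⟩
      · intro h t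
        obtain ⟨u, x, rfl⟩ := U.exists_tmk t
        rfl)
    (fun X Y => by
      rw [← of_sum]
      symm
      apply of_eq_of_isIso
      refine GSet.IsIso.of_bijective
        (X := (U.app X).sum (U.app Y)) (Y := U.app (X.sum Y))
        (Sum.elim
          (U.tlift (fun u x => U.tmk (X := X.carrier ⊕ Y.carrier) u (Sum.inl x))
            (fun g u x => U.tmk_op_smul _ _ _))
          (U.tlift (fun u x => U.tmk (X := X.carrier ⊕ Y.carrier) u (Sum.inr x))
            (fun g u x => U.tmk_op_smul _ _ _)))
        ⟨?_, ?_⟩ ?_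
      · rintro (s | s) (t | t) hst <;>
          obtain ⟨u, x, rfl⟩ := U.exists_tmk s <;>
          obtain ⟨u', x', rfl⟩ := U.exists_tmk t <;>
          obtain ⟨g, h, h'⟩ := U.tmk_inj (X := X.carrier ⊕ Y.carrier) _ _ _ _ hst
        · exact congrArg Sum.inl (U.tmk_eq g h (Sum.inl_injective h'))
        · cases h'
        · cases h'
        · exact congrArg Sum.inr (U.tmk_eq g h (Sum.inr_injective h'))
      · intro t
        obtain ⟨u, x | x, rfl⟩ := U.exists_tmk (X := X.carrier ⊕ Y.carrier) t
        · exact ⟨Sum.inl (U.tmk u x), rfl⟩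
        · exact ⟨Sum.inr (U.tmk u x), rfl⟩
      · rintro h (t | t) <;> obtain ⟨u, x, rfl⟩ := U.exists_tmk t <;> rfl)

theorem map_of (U : Biset H G) (X : GSet G) : map U (of F X) = of F (U.app X) :=
  lift_of _ _ _ X

/-- The product `FB(G) × FB(H) → FB(G × H)`, `([X], [Y]) ↦ [X × Y]`. -/
def ext : FB F G →ₗ[F] FB F H →ₗ[F] FB F (G × H) :=
  lift (fun X => lift (fun Y => of F (X.prod Y))
      (fun Y Y' ⟨e, he⟩ => of_eq_of_isIso
        ⟨Equiv.prodCongr (Equiv.refl _) e, fun g p => Prod.ext rfl (he g.2 p.2)⟩)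
      (fun Y Y' => by
        rw [← of_sum]
        exact of_eq_of_isIso ⟨Equiv.prodSumDistrib _ _ _, by
          rintro g ⟨x, y | y⟩ <;> rfl⟩))
    (fun X X' ⟨e, he⟩ => hom_ext fun Y => by
      rw [lift_of, lift_of]
      exact of_eq_of_isIso
        ⟨Equiv.prodCongr e (Equiv.refl _), fun g p => Prod.ext (he g.1 p.1) rfl⟩)
    (fun X X' => hom_ext fun Y => by
      rw [LinearMap.add_apply, lift_of, lift_of, lift_of, ← of_sum]
      exact of_eq_of_isIso ⟨Equiv.sumProdDistrib _ _ _, by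
          rintro g ⟨x | x, y⟩ <;> rfl⟩)

theorem ext_of (X : GSet G) (Y : GSet H) : ext (of F X) (of F Y) = of F (X.prod Y) := by
  unfold ext
  rw [lift_of, lift_of]

/-- The map `FB(H) → FB(G)` sending `[X]` to the set `X` with `G` acting through `f`. -/
def res (f : G →* H) : FB F H →ₗ[F] FB F G :=
  lift (fun X => of F (X.res f))
    (fun _ _ ⟨e, he⟩ => of_eq_of_isIso ⟨e, fun g x => he (f g) x⟩)
    (fun X Y => by
      rw [← of_sum]
      exact of_eq_of_isIso ⟨Equiv.refl _, by rintro g (x | x) <;> rfl⟩)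

theorem res_of (f : G →* H) (X : GSet H) : res f (of F X) = of F (X.res f) :=
  lift_of _ _ _ X

/-! ### Functoriality -/

theorem map_eq_of_isIso {U V : Biset H G} (h : U.IsIso V) :
    (map U : FB F G →ₗ[F] FB F H) = map V := by
  obtain ⟨e, h1, h2⟩ := h
  refine hom_ext fun X => ?_
  rw [map_of, map_of]
  apply of_eq_of_isIso
  refine GSet.IsIso.of_bijective
    (U.tlift (fun u x => V.tmk (e u) x) (fun g u x => by rw [h2, V.tmk_op_smul])) ⟨?_, ?_⟩ ?_
  · intro s t hst
    obtain ⟨u, x, rfl⟩ := U.exists_tmk s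
    obtain ⟨u', x', rfl⟩ := U.exists_tmk t
    obtain ⟨g, h, h'⟩ := V.tmk_inj (e u) x (e u') x' hst
    rw [← h2] at h
    exact U.tmk_eq g (e.injective h) h'
  · intro t
    obtain ⟨v, x, rfl⟩ := V.exists_tmk t
    exact ⟨U.tmk (e.symm v) x, congrArg (fun v => V.tmk v x) (e.apply_symm_apply v)⟩
  · intro h t
    obtain ⟨u, x, rfl⟩ := U.exists_tmk t
    change V.tmk (e (h • u)) x = V.tmk (h • e u) x
    rw [h1]

theorem map_sum (U V : Biset H G) :
    (map (U.sum V) : FB F G →ₗ[F] FB F H) = map U + map V := by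
  refine hom_ext fun X => ?_
  rw [LinearMap.add_apply, map_of, map_of, map_of, ← of_sum]
  symm
  apply of_eq_of_isIso
  refine GSet.IsIso.of_bijective
    (X := (U.app X).sum (V.app X)) (Y := (U.sum V).app X)
    (Sum.elim
      (U.tlift (fun u x => (U.sum V).tmk (Sum.inl u) x)
        (fun g u x => (U.sum V).tmk_op_smul g (Sum.inl u) x))
      (V.tlift (fun u x => (U.sum V).tmk (Sum.inr u) x)
        (fun g u x => (U.sum V).tmk_op_smul g (Sum.inr u) x)))
    ⟨?_, ?_⟩ ?_
  · rintro (s | s) (t | t) hst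
    · obtain ⟨u, x, rfl⟩ := U.exists_tmk s
      obtain ⟨u', x', rfl⟩ := U.exists_tmk t
      obtain ⟨g, h, h'⟩ := (U.sum V).tmk_inj (Sum.inl u) x (Sum.inl u') x' hst
      exact congrArg Sum.inl (U.tmk_eq g (Sum.inl_injective h) h')
    · obtain ⟨u, x, rfl⟩ := U.exists_tmk s
      obtain ⟨u', x', rfl⟩ := V.exists_tmk t
      obtain ⟨g, h, h'⟩ := (U.sum V).tmk_inj _ _ _ _ hst
      cases h
    · obtain ⟨u, x, rfl⟩ := V.exists_tmk s
      obtain ⟨u', x', rfl⟩ := U.exists_tmk t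
      obtain ⟨g, h, h'⟩ := (U.sum V).tmk_inj _ _ _ _ hst
      cases h
    · obtain ⟨u, x, rfl⟩ := V.exists_tmk s
      obtain ⟨u', x', rfl⟩ := V.exists_tmk t
      obtain ⟨g, h, h'⟩ := (U.sum V).tmk_inj (Sum.inr u) x (Sum.inr u') x' hst
      exact congrArg Sum.inr (V.tmk_eq g (Sum.inr_injective h) h')
  · intro t
    obtain ⟨u | u, x, rfl⟩ := (U.sum V).exists_tmk t
    · exact ⟨Sum.inl (U.tmk u x), rfl⟩
    · exact ⟨Sum.inr (V.tmk u x), rfl⟩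
  · rintro h (t | t)
    · obtain ⟨u, x, rfl⟩ := U.exists_tmk t
      rfl
    · obtain ⟨u, x, rfl⟩ := V.exists_tmk t
      rfl

theorem map_ident [Finite G] : (map (Biset.ident G) : FB F G →ₗ[F] FB F G) = LinearMap.id := by
  refine hom_ext fun X => ?_
  rw [map_of, LinearMap.id_apply]
  symm
  apply of_eq_of_isIso
  refine GSet.IsIso.of_bijective (Y := (Biset.ident G).app X)
    (fun x => (Biset.ident G).tmk (1 : G) x) ⟨?_, ?_⟩ ?_
  · intro x y hxy
    obtain ⟨g, h, h'⟩ := (Biset.ident G).tmk_inj (1 : G) x (1 : G) y hxy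
    have h1 : (1 : G) * g = 1 := h
    rw [one_mul] at h1
    rw [h', h1, one_smul]
  · intro t
    obtain ⟨u, x, rfl⟩ := (Biset.ident G).exists_tmk t
    refine ⟨@HSMul.hSMul G X.carrier _ _ u x, ?_⟩
    refine ((Biset.ident G).tmk_op_smul (X := X.carrier) u (1 : G) x).symm.trans ?_
    exact congrArg (fun v => (Biset.ident G).tmk v x) (one_mul (show G from u))
  · intro g x
    change (Biset.ident G).tmk (1 : G) (g • x) = (Biset.ident G).tmk (g * 1) x
    refine ((Biset.ident G).tmk_op_smul (X := X.carrier) g (1 : G) x).symm.trans ?_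
    exact congrArg (fun v => (Biset.ident G).tmk v x)
      (show (1 : G) * g = g * 1 by simp)

theorem map_comp (V : Biset J H) (U : Biset H G) :
    (map (V.comp U) : FB F G →ₗ[F] FB F J) = map V ∘ₗ map U := by
  refine hom_ext fun X => ?_
  rw [LinearMap.comp_apply, map_of, map_of, map_of]
  symm
  apply of_eq_of_isIso
  refine GSet.IsIso.of_bijective (X := V.app (U.app X)) (Y := (V.comp U).app X)
    (V.tlift (fun v => U.tlift (fun u x => (V.comp U).tmk (V.tmk v u) x) ?_) ?_) ⟨?_, ?_⟩ ?_
  · intro g u x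
    exact (V.comp U).tmk_op_smul g (V.tmk v u) x
  · intro h v t
    obtain ⟨u, x, rfl⟩ := U.exists_tmk t
    exact congrArg (fun w => (V.comp U).tmk w x) (V.tmk_op_smul h v u)
  · intro s t hst
    obtain ⟨v, s', rfl⟩ := V.exists_tmk s
    obtain ⟨u, x, rfl⟩ := U.exists_tmk s'
    obtain ⟨v', t', rfl⟩ := V.exists_tmk t
    obtain ⟨u', x', rfl⟩ := U.exists_tmk t'
    obtain ⟨g, h, h'⟩ := (V.comp U).tmk_inj (V.tmk v u) x (V.tmk v' u') x' hst
    obtain ⟨k, hk, hk'⟩ := V.tmk_inj v (op g • u) v' u' h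
    refine V.tmk_eq (X := U.Tensor X.carrier) k hk ?_
    exact U.tmk_eq g hk' h'
  · intro t
    obtain ⟨w, x, rfl⟩ := (V.comp U).exists_tmk t
    obtain ⟨v, u, rfl⟩ := V.exists_tmk w
    exact ⟨V.tmk v (U.tmk u x), rfl⟩
  · intro j t
    obtain ⟨v, s, rfl⟩ := V.exists_tmk t
    obtain ⟨u, x, rfl⟩ := U.exists_tmk s
    rfl

theorem induction {p : FB F G → Prop} (h0 : p 0) (hof : ∀ X, p (of F X))
    (hadd : ∀ a b, p a → p b → p (a + b)) (hsmul : ∀ (c : F) a, p a → p (c • a))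
    (a : FB F G) : p a := by
  induction a using Submodule.Quotient.induction_on with
  | H a =>
    induction a using Finsupp.induction_linear with
    | zero => exact h0
    | add x y hx hy => exact hadd _ _ hx hy
    | single X c =>
      have h := hsmul c _ (hof X)
      unfold of at h
      rw [← Submodule.Quotient.mk_smul, Finsupp.smul_single, smul_eq_mul, mul_one] at h
      exact h

theorem map_iso_of [Finite H] (f : G ≃* H) (X : GSet G) :
    map (Biset.iso f) (of F X) = of F (X.res f.symm.toMonoidHom) := by
  rw [map_of]
  symm
  apply of_eq_of_isIso
  refine GSet.IsIso.of_bijective (X := X.res f.symm.toMonoidHom) (Y := (Biset.iso f).app X)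
    (fun x => (Biset.iso f).tmk (X := X.carrier) (1 : H) x) ⟨?_, ?_⟩ ?_
  · intro x y hxy
    obtain ⟨g, h, h'⟩ := (Biset.iso f).tmk_inj (X := X.carrier) (1 : H) x (1 : H) y hxy
    have h1 : (1 : H) * f g = 1 := h
    have h2 : g = 1 := by simpa using h1
    rw [h', h2]
    exact one_smul G (show X.carrier from y)
  · intro t
    obtain ⟨u, x, rfl⟩ := (Biset.iso f).exists_tmk t
    refine ⟨f.symm (show H from u) • x, ?_⟩
    refine (Biset.iso f).tmk_eq (X := X.carrier) (f.symm (show H from u)) ?_ rfl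
    change (1 : H) * f (f.symm u) = u
    rw [one_mul]
    exact f.apply_symm_apply u
  · intro h x
    change (Biset.iso f).tmk (X := X.carrier) (1 : H) (f.symm h • (show X.carrier from x)) =
      (Biset.iso f).tmk (X := X.carrier) (h * 1 : H) x
    symm
    refine (Biset.iso f).tmk_eq (X := X.carrier) (f.symm h)⁻¹ ?_ ?_
    · change h * 1 * f (f.symm h)⁻¹ = 1
      simp
    · exact (inv_smul_smul (f.symm h) (show X.carrier from x)).symm

end FB

/-! ### The shifted functor -/

namespace Biset

variable {G H J : Type u} [Group G] [Group H] [Group J] (K : Type u) [Group K] [Finite K]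

theorem shift_isIso {U V : Biset H G} (h : U.IsIso V) : (U.shift K).IsIso (V.shift K) := by
  obtain ⟨e, h1, h2⟩ := h
  exact ⟨Equiv.prodCongr e (Equiv.refl _), fun h p => Prod.ext (h1 h.1 p.1) rfl,
    fun g p => Prod.ext (h2 g.1 p.1) rfl⟩

theorem shift_sum (U V : Biset H G) :
    ((U.sum V).shift K).IsIso ((U.shift K).sum (V.shift K)) :=
  ⟨Equiv.sumProdDistrib _ _ _, by rintro h ⟨u | u, k⟩ <;> rfl, by rintro g ⟨u | u, k⟩ <;> rfl⟩

theorem shift_iso [Finite H] (f : G ≃* H) :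
    ((iso f).shift K).IsIso (iso (f.prodCongr (MulEquiv.refl K))) :=
  ⟨Equiv.refl _, fun _ _ => rfl, fun _ _ => rfl⟩

theorem shift_comp (V : Biset J H) (U : Biset H G) :
    ((V.comp U).shift K).IsIso ((V.shift K).comp (U.shift K)) := by
  refine IsIso.of_bijective (U := (V.comp U).shift K) (V := (V.shift K).comp (U.shift K))
    (fun p => V.tlift (fun v u => (V.shift K).tmk (X := (U.shift K).carrier)
      (v, (1 : K)) (u, (p.2 : K))) ?_ p.1) ⟨?_, ?_⟩ ?_ ?_
  · intro h v u
    refine (V.shift K).tmk_eq (X := (U.shift K).carrier) (h⁻¹, 1) ?_ ?_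
    · refine Prod.ext ?_ (show (1 : K) * 1 = 1 from mul_one 1)
      change op h⁻¹ • op h • v = v
      rw [op_inv, inv_smul_smul]
    · refine Prod.ext ?_ (one_mul (show K from p.2)).symm
      change u = h⁻¹ • h • u
      rw [inv_smul_smul]
  · rintro ⟨s, k⟩ ⟨t, l⟩ hst
    obtain ⟨v, u, rfl⟩ := V.exists_tmk s
    obtain ⟨v', u', rfl⟩ := V.exists_tmk t
    obtain ⟨⟨h, c⟩, h1, h2⟩ := (V.shift K).tmk_inj (X := (U.shift K).carrier)
      (v, (1 : K)) (u, k) (v', (1 : K)) (u', l) hst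
    have hc : (1 : K) * c = 1 := congrArg Prod.snd h1
    have hk : k = c * (show K from l) := congrArg Prod.snd h2
    rw [one_mul] at hc
    refine Prod.ext (V.tmk_eq h (congrArg Prod.fst h1) (congrArg Prod.fst h2)) ?_
    exact hk.trans ((congrArg (fun d => d * (show K from l)) hc).trans
      (one_mul (show K from l)))
  · intro t
    obtain ⟨⟨v, k⟩, ⟨u, l⟩, rfl⟩ := (V.shift K).exists_tmk t
    refine ⟨(V.tmk v u, (show K from k) * (show K from l)), ?_⟩
    refine (V.shift K).tmk_eq (X := (U.shift K).carrier) (1, k) ?_ ?_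
    · refine Prod.ext ?_ (one_mul (show K from k))
      change op (1 : H) • v = v
      simp
    · refine Prod.ext ?_ rfl
      change u = (1 : H) • u
      simp
  · rintro ⟨j, c⟩ ⟨t, k⟩
    obtain ⟨v, u, rfl⟩ := V.exists_tmk t
    refine (V.shift K).tmk_eq (X := (U.shift K).carrier) (1, c) ?_ ?_
    · refine Prod.ext ?_ ?_
      · change op (1 : H) • j • v = j • v
        simp
      · exact (one_mul c).trans (mul_one c).symm
    · refine Prod.ext ?_ ?_
      · change u = (1 : H) • u
        simp
      · rfl
  · rintro ⟨g, c⟩ ⟨t, k⟩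
    obtain ⟨v, u, rfl⟩ := V.exists_tmk t
    rfl

end Biset

/-- The homomorphism `(g, h, k) ↦ ((g, k), (h, k))`, i.e. the inverse of the isomorphism `δ` from
its image `Δ` to `G × H × K`, followed by the inclusion of `Δ`. -/
def diag (G H K : Type u) [Group G] [Group H] [Group K] : (G × H) × K →* (G × K) × (H × K) where
  toFun x := ((x.1.1, x.2), (x.1.2, x.2))
  map_one' := rfl
  map_mul' _ _ := rfl

namespace FB

variable {F}
variable {G H J : Type u} [Group G] [Group H] [Group J] {K : Type u} [Group K]

/-- The product `FB_K(G) × FB_K(H) → FB_K(G × H)` of the shifted functor: the product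
`FB(G × K) × FB(H × K) → FB(G × K × H × K)` followed by restriction to `Δ ≅ G × H × K`. -/
def mulK : FB F (G × K) →ₗ[F] FB F (H × K) →ₗ[F] FB F ((G × H) × K) :=
  ext.compr₂ (res (diag G H K))

theorem mulK_of (X : GSet (G × K)) (Y : GSet (H × K)) :
    mulK (of F X) (of F Y) = of F ((X.prod Y).res (diag G H K)) := by
  unfold mulK
  rw [LinearMap.compr₂_apply, ext_of, res_of]

/-- The identity element of `FB_K(1)`: the class of the one-point set. -/
def one (F : Type v) [Field F] (K : Type u) [Group K] : FB F (PUnit.{u + 1} × K) :=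
  of F (GSet.point _)

/-- The map `FB_K(U) = FB(U × K)`. -/
def mapK (K : Type u) [Group K] [Finite K] (U : Biset H G) : FB F (G × K) →ₗ[F] FB F (H × K) :=
  map (U.shift K)

theorem mulK_mapK [Finite K] {G' H' : Type u} [Group G'] [Group H'] (U : Biset G' G)
    (V : Biset H' H) (a : FB F (G × K)) (b : FB F (H × K)) :
    mulK (mapK K U a) (mapK K V b) = mapK K (U.prod V) (mulK a b) := by
  unfold mapK
  induction a using induction with
  | h0 => simp
  | hadd a a' h h' => simp only [map_add, LinearMap.add_apply, h, h']
  | hsmul c a h => simp only [map_smul, LinearMap.smul_apply, h]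
  | hof X =>
  induction b using induction with
  | h0 => simp
  | hadd a a' h h' => simp only [map_add, h, h']
  | hsmul c a h => simp only [map_smul, h]
  | hof Y =>
  rw [map_of, map_of, mulK_of, mulK_of, map_of]
  symm
  apply of_eq_of_isIso
  refine GSet.IsIso.of_bijective
    (X := ((U.prod V).shift K).app ((X.prod Y).res (diag G H K)))
    (Y := (((U.shift K).app X).prod ((V.shift K).app Y)).res (diag G' H' K))
    (((U.prod V).shift K).tlift (fun u x =>
      ((U.shift K).tmk (X := X.carrier) (u.1.1, u.2) x.1,
        (V.shift K).tmk (X := Y.carrier) (u.1.2, u.2) x.2)) ?_) ⟨?_, ?_⟩ ?_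
  · rintro ⟨⟨g, h⟩, k⟩ ⟨⟨u, v⟩, c⟩ ⟨x, y⟩
    exact Prod.ext ((U.shift K).tmk_op_smul (X := X.carrier) (g, k) (u, c) x)
      ((V.shift K).tmk_op_smul (X := Y.carrier) (h, k) (v, c) y)
  · intro s t hst
    obtain ⟨⟨⟨u, v⟩, c⟩, ⟨x, y⟩, rfl⟩ := Biset.exists_tmk _ s
    obtain ⟨⟨⟨u', v'⟩, c'⟩, ⟨x', y'⟩, rfl⟩ := Biset.exists_tmk _ t
    obtain ⟨⟨g, k⟩, h1, h2⟩ := (U.shift K).tmk_inj (X := X.carrier) (u, c) x (u', c') x'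
      (congrArg Prod.fst hst)
    obtain ⟨⟨h, l⟩, h3, h4⟩ := (V.shift K).tmk_inj (X := Y.carrier) (v, c) y (v', c') y'
      (congrArg Prod.snd hst)
    have hk : (show K from c) * k = c' := congrArg Prod.snd h1
    have hl : (show K from c) * l = c' := congrArg Prod.snd h3
    obtain rfl : k = l := mul_left_cancel (hk.trans hl.symm)
    exact Biset.tmk_eq _ ((g, h), k)
      (Prod.ext (Prod.ext (show op g • u = u' from congrArg Prod.fst h1)
        (show op h • v = v' from congrArg Prod.fst h3)) hk) (Prod.ext h2 h4)
  · rintro ⟨s, t⟩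
    obtain ⟨⟨u, k⟩, x, rfl⟩ := (U.shift K).exists_tmk s
    obtain ⟨⟨v, l⟩, y, rfl⟩ := (V.shift K).exists_tmk t
    have key : ∀ {A B : Type u} [Group A] [Group B] (W : Biset B A) (Z : GSet (A × K))
        (w : W.carrier) (c : K) (z : Z.carrier),
        (W.shift K).tmk (X := Z.carrier) (w, (1 : K)) (((1 : A), c) • z) =
          (W.shift K).tmk (X := Z.carrier) (w, c) z := by
      intro A B _ _ W Z w c z
      refine (W.shift K).tmk_eq (X := Z.carrier) (1, c) (Prod.ext ?_ (one_mul c)) rfl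
      change op (1 : A) • w = w
      simp
    exact ⟨((U.prod V).shift K).tmk (X := ((X.prod Y).res (diag G H K)).carrier)
      ((u, v), (1 : K))
      (((1 : G), (show K from k)) • x, ((1 : H), (show K from l)) • y),
      Prod.ext (key U X u k x) (key V Y v l y)⟩
  · rintro ⟨⟨g, h⟩, k⟩ t
    obtain ⟨⟨⟨u, v⟩, c⟩, ⟨x, y⟩, rfl⟩ := Biset.exists_tmk _ t
    rfl

theorem mapK_iso_of [Finite K] [Finite H] (f : G ≃* H) (X : GSet (G × K)) :
    mapK K (Biset.iso f) (of F X) =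
      of F (X.res (f.prodCongr (MulEquiv.refl K)).symm.toMonoidHom) := by
  unfold mapK
  rw [map_eq_of_isIso (Biset.shift_iso K f), map_iso_of]

theorem mulK_assoc [Finite K] [Finite G] [Finite H] [Finite J]
    (a : FB F (G × K)) (b : FB F (H × K)) (c : FB F (J × K)) :
    mapK K (Biset.iso MulEquiv.prodAssoc) (mulK (mulK a b) c) = mulK a (mulK b c) := by
  induction a using induction with
  | h0 => simp
  | hadd a a' h h' => simp only [map_add, LinearMap.add_apply, h, h']
  | hsmul c a h => simp only [map_smul, LinearMap.smul_apply, h]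
  | hof X =>
  induction b using induction with
  | h0 => simp
  | hadd a a' h h' => simp only [map_add, LinearMap.add_apply, h, h']
  | hsmul c a h => simp only [map_smul, LinearMap.smul_apply, h]
  | hof Y =>
  induction c using induction with
  | h0 => simp
  | hadd a a' h h' => simp only [map_add, h, h']
  | hsmul c a h => simp only [map_smul, h]
  | hof Z =>
  rw [mulK_of, mulK_of, mulK_of, mulK_of, mapK_iso_of]
  exact of_eq_of_isIso ⟨Equiv.prodAssoc _ _ _, fun _ _ => rfl⟩

theorem one_mulK [Finite K] [Finite G] (a : FB F (G × K)) :
    mapK K (Biset.iso MulEquiv.uniqueProd) (mulK (one F K) a) = a := by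
  induction a using induction with
  | h0 => simp
  | hadd a a' h h' => simp only [map_add, h, h']
  | hsmul c a h => simp only [map_smul, h]
  | hof X =>
  unfold one
  rw [mulK_of, mapK_iso_of]
  exact of_eq_of_isIso ⟨Equiv.punitProd _, fun _ _ => rfl⟩

theorem mapK_eq_of_isIso [Finite K] {U V : Biset H G} (h : U.IsIso V) :
    (mapK K U : FB F (G × K) →ₗ[F] FB F (H × K)) = mapK K V :=
  map_eq_of_isIso (Biset.shift_isIso K h)

theorem mapK_sum [Finite K] (U V : Biset H G) :
    (mapK K (U.sum V) : FB F (G × K) →ₗ[F] FB F (H × K)) = mapK K U + mapK K V :=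
  (map_eq_of_isIso (Biset.shift_sum K U V)).trans (map_sum _ _)

theorem mapK_ident [Finite K] [Finite G] :
    (mapK K (Biset.ident G) : FB F (G × K) →ₗ[F] FB F (G × K)) = LinearMap.id :=
  (map_eq_of_isIso (Biset.shift_iso K _)).trans map_ident

theorem mapK_comp [Finite K] (V : Biset J H) (U : Biset H G) :
    (mapK K (V.comp U) : FB F (G × K) →ₗ[F] FB F (J × K)) = mapK K V ∘ₗ mapK K U :=
  (map_eq_of_isIso (Biset.shift_comp K V U)).trans (map_comp _ _)

end FB

end Burnside

/-! ## Biset functors and modules over the Green biset functor `FB_K` -/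

/-- A biset functor over `F`. An `F`-linear functor on the biset category is given by its values
on bisets, subject to invariance under isomorphism, additivity for disjoint unions, and
compatibility with identities and composition. -/
structure BisetFunctor (F : Type v) [Field F] where
  obj : ∀ (G : Type u) [Group G] [Finite G], Type w
  [addCommGroup : ∀ (G : Type u) [Group G] [Finite G], AddCommGroup (obj G)]
  [module : ∀ (G : Type u) [Group G] [Finite G], Module F (obj G)]
  map : ∀ {G H : Type u} [Group G] [Group H] [Finite G] [Finite H],
    Biset H G → (obj G →ₗ[F] obj H)
  map_eq_of_isIso : ∀ {G H : Type u} [Group G] [Group H] [Finite G] [Finite H]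
    (U V : Biset H G), U.IsIso V → map U = map V
  map_sum : ∀ {G H : Type u} [Group G] [Group H] [Finite G] [Finite H]
    (U V : Biset H G), map (U.sum V) = map U + map V
  map_ident : ∀ {G : Type u} [Group G] [Finite G], map (Biset.ident G) = LinearMap.id
  map_comp : ∀ {G H J : Type u} [Group G] [Group H] [Group J] [Finite G] [Finite H] [Finite J]
    (V : Biset J H) (U : Biset H G), map (V.comp U) = map V ∘ₗ map U

attribute [instance] BisetFunctor.addCommGroup BisetFunctor.module

/-- A (left) `FB_K`-module: a biset functor `M` with products `FB_K(G) × M(H) → M(G × H)`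
that are associative, bifunctorial and unital. -/
structure FBKModule (F : Type v) [Field F] (K : Type u) [Group K] [Finite K] extends
    BisetFunctor.{u, v, w} F where
  mul : ∀ {G H : Type u} [Group G] [Group H] [Finite G] [Finite H],
    FB F (G × K) →ₗ[F] obj H →ₗ[F] obj (G × H)
  mul_map : ∀ {G G' H H' : Type u} [Group G] [Group G'] [Group H] [Group H'] [Finite G]
    [Finite G'] [Finite H] [Finite H'] (U : Biset G' G) (V : Biset H' H) (a : FB F (G × K))
    (m : obj H), mul (FB.mapK K U a) (map V m) = map (U.prod V) (mul a m)
  mul_assoc : ∀ {G H J : Type u} [Group G] [Group H] [Group J] [Finite G] [Finite H] [Finite J]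
    (a : FB F (G × K)) (b : FB F (H × K)) (m : obj J),
    map (Biset.iso MulEquiv.prodAssoc) (mul (FB.mulK a b) m) = mul a (mul b m)
  one_mul : ∀ {G : Type u} [Group G] [Finite G] (m : obj G),
    map (Biset.iso MulEquiv.uniqueProd) (mul (FB.one F K) m) = m

section Modules

variable {F : Type v} [Field F] {K : Type u} [Group K] [Finite K]

/-- `FB_K` as a left module over itself. -/
def shiftedBurnside (F : Type v) [Field F] (K : Type u) [Group K] [Finite K] :
    FBKModule.{u, v, max (u + 1) v} F K where
  obj G := FB F (G × K)
  map U := FB.mapK K U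
  map_eq_of_isIso _ _ h := FB.mapK_eq_of_isIso h
  map_sum U V := FB.mapK_sum U V
  map_ident := FB.mapK_ident
  map_comp V U := FB.mapK_comp V U
  mul := FB.mulK
  mul_map U V a m := FB.mulK_mapK U V a m
  mul_assoc a b m := FB.mulK_assoc a b m
  one_mul m := FB.one_mulK m

namespace FBKModule

/-- A submodule of an `FB_K`-module. -/
@[ext]
structure Sub (M : FBKModule.{u, v, w} F K) where
  carrier : ∀ (G : Type u) [Group G] [Finite G], Submodule F (M.obj G)
  map_mem : ∀ {G H : Type u} [Group G] [Group H] [Finite G] [Finite H] (U : Biset H G)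
    {m : M.obj G}, m ∈ carrier G → M.map U m ∈ carrier H
  mul_mem : ∀ {G H : Type u} [Group G] [Group H] [Finite G] [Finite H] (a : FB F (G × K))
    {m : M.obj H}, m ∈ carrier H → M.mul a m ∈ carrier (G × H)

namespace Sub

variable {M : FBKModule.{u, v, w} F K}

instance : LE (Sub M) :=
  ⟨fun N N' => ∀ (G : Type u) [Group G] [Finite G], N.carrier G ≤ N'.carrier G⟩

/-- The submodule generated by an element `x` of `M(G)`: the intersection of the submodules
containing it. -/
def span (G : Type u) [Group G] [Finite G] (x : M.obj G) : Sub M where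
  carrier H _ _ := ⨅ (N : Sub M) (_ : x ∈ N.carrier G), N.carrier H
  map_mem U m hm := by
    simp only [Submodule.mem_iInf] at hm ⊢
    exact fun N hN => N.map_mem U (hm N hN)
  mul_mem a m hm := by
    simp only [Submodule.mem_iInf] at hm ⊢
    exact fun N hN => N.mul_mem a (hm N hN)

/-- The sum of a family of submodules. -/
def sum {ι : Type*} (N : ι → Sub M) : Sub M where
  carrier G _ _ := ⨆ i, (N i).carrier G
  map_mem {G H _ _ _ _} U m hm := by
    have h : (⨆ i, (N i).carrier G) ≤ (⨆ i, (N i).carrier H).comap (M.map U) :=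
      iSup_le fun i x hx => Submodule.mem_iSup_of_mem i ((N i).map_mem U hx)
    exact h hm
  mul_mem {G H _ _ _ _} a m hm := by
    have h : (⨆ i, (N i).carrier H) ≤ (⨆ i, (N i).carrier (G × H)).comap (M.mul a) :=
      iSup_le fun i x hx => Submodule.mem_iSup_of_mem i ((N i).mul_mem a hx)
    exact h hm

/-- The evaluation at `G` of the quotient `N / N'`, for submodules `N' ≤ N`
(in general, of `N / (N ∩ N')`). -/
abbrev QuotObj (N N' : Sub M) (G : Type u) [Group G] [Finite G] : Type w :=
  N.carrier G ⧸ (N'.carrier G).submoduleOf (N.carrier G)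

/-- The action of bisets on `N / N'`. -/
def quotMap (N N' : Sub M) {G H : Type u} [Group G] [Group H] [Finite G] [Finite H]
    (U : Biset H G) : N.QuotObj N' G →ₗ[F] N.QuotObj N' H :=
  Submodule.mapQ _ _ ((M.map U).restrict fun _ hm => N.map_mem U hm)
    fun _ hm => N'.map_mem U hm

/-- The products on `N / N'`. -/
def quotMul (N N' : Sub M) {G H : Type u} [Group G] [Group H] [Finite G] [Finite H] :
    FB F (G × K) →ₗ[F] N.QuotObj N' H →ₗ[F] N.QuotObj N' (G × H) :=
  LinearMap.mk₂ F
    (fun a => Submodule.mapQ _ _ ((M.mul a).restrict fun _ hm => N.mul_mem a hm)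
      fun _ hm => N'.mul_mem a hm)
    (fun a b m => by
      induction m using Submodule.Quotient.induction_on with
      | H m =>
        refine congrArg (Submodule.Quotient.mk) (Subtype.ext ?_)
        exact congrArg (fun f => f m.1) (map_add M.mul a b))
    (fun c a m => by
      induction m using Submodule.Quotient.induction_on with
      | H m =>
        refine congrArg (Submodule.Quotient.mk) (Subtype.ext ?_)
        exact congrArg (fun f => f m.1) (map_smul M.mul c a))
    (fun a m n => map_add _ m n)
    (fun c a m => map_smul _ c m)

/-- The `FB_K`-module `N / N'`, for submodules `N' ≤ N` (in general, `N / (N ∩ N')`). -/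
def quot (N N' : Sub M) : FBKModule.{u, v, w} F K where
  obj G := N.QuotObj N' G
  map U := N.quotMap N' U
  map_eq_of_isIso U V h := by
    refine Submodule.linearMap_qext _ (LinearMap.ext fun m => ?_)
    refine congrArg (Submodule.Quotient.mk) (Subtype.ext ?_)
    exact congrArg (fun f => f m.1) (M.map_eq_of_isIso U V h)
  map_sum U V := by
    refine Submodule.linearMap_qext _ (LinearMap.ext fun m => ?_)
    refine congrArg (Submodule.Quotient.mk) (Subtype.ext ?_)
    exact congrArg (fun f => f m.1) (M.map_sum U V)
  map_ident := by
    refine Submodule.linearMap_qext _ (LinearMap.ext fun m => ?_)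
    refine congrArg (Submodule.Quotient.mk) (Subtype.ext ?_)
    exact congrArg (fun f => f m.1) M.map_ident
  map_comp V U := by
    refine Submodule.linearMap_qext _ (LinearMap.ext fun m => ?_)
    refine congrArg (Submodule.Quotient.mk) (Subtype.ext ?_)
    exact congrArg (fun f => f m.1) (M.map_comp V U)
  mul := N.quotMul N'
  mul_map U V a m := by
    induction m using Submodule.Quotient.induction_on with
    | H m =>
      refine congrArg (Submodule.Quotient.mk) (Subtype.ext ?_)
      exact M.mul_map U V a m.1
  mul_assoc a b m := by
    induction m using Submodule.Quotient.induction_on with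
    | H m =>
      refine congrArg (Submodule.Quotient.mk) (Subtype.ext ?_)
      exact M.mul_assoc a b m.1
  one_mul m := by
    induction m using Submodule.Quotient.induction_on with
    | H m =>
      refine congrArg (Submodule.Quotient.mk) (Subtype.ext ?_)
      exact M.one_mul m.1

end Sub

/-- Isomorphisms of `FB_K`-modules. -/
structure Iso (M N : FBKModule.{u, v, w} F K) where
  equiv : ∀ (G : Type u) [Group G] [Finite G], M.obj G ≃ₗ[F] N.obj G
  map_equiv : ∀ {G H : Type u} [Group G] [Group H] [Finite G] [Finite H] (U : Biset H G)
    (m : M.obj G), equiv H (M.map U m) = N.map U (equiv G m)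
  mul_equiv : ∀ {G H : Type u} [Group G] [Group H] [Finite G] [Finite H] (a : FB F (G × K))
    (m : M.obj H), equiv (G × H) (M.mul a m) = N.mul a (equiv H m)

/-- A simple `FB_K`-module: a non-zero module whose only submodules are zero and itself. -/
structure IsSimple (M : FBKModule.{u, v, w} F K) : Prop where
  nonzero : ∃ (G : Type u) (_ : Group G) (_ : Finite G), Nontrivial (M.obj G)
  eq_bot_or_eq_top : ∀ N : Sub M,
    (∀ (G : Type u) [Group G] [Finite G], N.carrier G = ⊥) ∨
      (∀ (G : Type u) [Group G] [Finite G], N.carrier G = ⊤)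

end FBKModule

end Modules

/-! ## Idempotents, groups over `K`, and `B_K`-groups -/

/-- The Möbius function `μ(X, Y)` of the poset of subgroups of a finite group. -/
def moebius {G : Type u} [Group G] [Finite G] (X Y : Subgroup G) : ℤ := by
  classical
  letI : Fintype (Subgroup G) := Fintype.ofFinite _
  letI : LocallyFiniteOrder (Subgroup G) := Fintype.toLocallyFiniteOrder
  exact IncidenceAlgebra.mu ℤ X Y

/-- The idempotent `e_L^G` of `FB(G)` attached to a subgroup `L` of `G`:
`(1 / |N_G(L)|) ∑_{X ≤ L} |X| μ(X, L) [G / X]`. -/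
def idem (F : Type v) [Field F] {G : Type u} [Group G] [Finite G] (L : Subgroup G) : FB F G :=
  (Nat.card (Subgroup.normalizer (L : Set G)) : F)⁻¹ •
    ∑ᶠ (X : Subgroup G) (_ : X ≤ L),
      ((Nat.card X : F) * (moebius X L : F)) • FB.of F (GSet.coset X)

/-- The rational number `m_{L,N} = (1 / |L|) ∑_{X ≤ L, X N = L} |X| μ(X, L)`. For `N` normal,
`X N` is the join `X ⊔ N`. -/
def mConst {L : Type u} [Group L] [Finite L] (N : Subgroup L) : ℚ :=
  (Nat.card L : ℚ)⁻¹ *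
    ∑ᶠ (X : Subgroup L) (_ : X ⊔ N = ⊤), (Nat.card X : ℚ) * (moebius X ⊤ : ℚ)

/-- A finite group over `K`. -/
structure GrpOver (K : Type u) [Group K] where
  L : Type u
  [group : Group L]
  [finite : Finite L]
  φ : L →* K

attribute [instance] GrpOver.group GrpOver.finite

namespace GrpOver

variable {K : Type u} [Group K]

/-- Morphisms are the homomorphisms `f : L → L'` such that `i ∘ φ = φ' ∘ f` for some inner
automorphism `i` of `K`. -/
instance : CategoryTheory.Category (GrpOver K) where
  Hom A B := {f : A.L →* B.L // ∃ k : K, ∀ l : A.L, k * A.φ l * k⁻¹ = B.φ (f l)}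
  id A := ⟨MonoidHom.id A.L, 1, by simp⟩
  comp f g := ⟨g.1.comp f.1, by
    obtain ⟨f, k, hf⟩ := f
    obtain ⟨g, k', hg⟩ := g
    refine ⟨k' * k, fun l => ?_⟩
    rw [MonoidHom.comp_apply, ← hg, ← hf]
    simp [mul_assoc]⟩

/-- `B` is a quotient of `A`: there is a surjective morphism from `A` to `B`. -/
def IsQuotient (A B : GrpOver K) : Prop := ∃ f : A ⟶ B, Function.Surjective f.1

/-- `B_K`-groups: `m_{L,N} = 0` for every non-trivial normal subgroup `N` of `L` contained
in the kernel of `φ`. -/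
def IsBKGroup (A : GrpOver K) : Prop :=
  ∀ N : Subgroup A.L, N.Normal → N ≠ ⊥ → N ≤ A.φ.ker → mConst N = 0

/-- The subgroup `L_φ = {(l, φ(l)) | l ∈ L}` of `L × K`. -/
def graph (A : GrpOver K) : Subgroup (A.L × K) := ((MonoidHom.id A.L).prod A.φ).range

variable [Finite K] (F : Type v) [Field F]

/-- The ideal `e_{L,φ}` of `FB_K` generated by the idempotent of `FB_K(L)` attached to `L_φ`. -/
def ideal (A : GrpOver K) : (shiftedBurnside F K).Sub :=
  FBKModule.Sub.span (M := shiftedBurnside F K) A.L (idem F A.graph)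

/-- The ideal `e⁰_{L,φ}`: the sum of the ideals `e_{M,ψ}` over the `B_K`-groups `(M,ψ)` that have
`(L,φ)` as a quotient and are not isomorphic to `(L,φ)`. -/
def ideal₀ (A : GrpOver K) : (shiftedBurnside F K).Sub :=
  FBKModule.Sub.sum
    (fun B : {B : GrpOver K // B.IsBKGroup ∧ B.IsQuotient A ∧ ¬ Nonempty (B ≅ A)} => B.1.ideal F)

/-- The `FB_K`-module `S_{L,φ} = e_{L,φ} / e⁰_{L,φ}`. -/
def simpleModule (A : GrpOver K) : FBKModule.{u, v, max (u + 1) v} F K :=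
  (A.ideal F).quot (A.ideal₀ F)

end GrpOver

end

end RelBGroup

/-! The proof replaces ideals of the Green functor by classes of groups over `K`. The mark of `[X]`
at `Z` is the number of fixed points of `Z` on `X`. In characteristic 0 marks separate the elements
of the Burnside algebra, and `gluck` (the idempotent up to a non-zero scalar) has non-zero marks
only on one conjugacy class of subgroups. Since the product of `gluck F f` with `a` is the mark of
`a` at the range of `f` times `gluck F f`, the evaluation of an ideal at `G` is spanned by the
idempotents it contains. Restriction and induction along the first projection show that whether the
idempotent of `X ≤ G × K` lies in an ideal depends only on `X` as a group over `K`. An ideal `I` is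
therefore the same as the class `I.Mem` (`mem_carrier_iff_ofSub`, `le_iff`).

The classes that occur are the `Closed` ones: stable under passing from a group to any group that
surjects onto it, and from a group to its image under a surjection whose kernel has non-zero
`tConst`. Both stabilities follow from restriction and induction (`closed_mem`). Conversely a closed
class defines an ideal, because `card_mul_mark_map_gluck` computes the marks of a biset applied to
an idempotent: a non-zero mark at `Z` forces a surjection of `Z` onto a quotient `L / N` with
non-zero `tConst N`.

Dividing out subgroups `N` with `m_{L,N} ≠ 0` as long as possible shows that every group over `K`
has a `B_K`-group quotient in the same closed classes (`exists_isBKGroup`). For a `B_K`-group `A`,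
the groups that surject onto `A` form a closed class (`IsBKGroup.isQuotient_of_hom`). This rests on
the identity `sum_tConst_restrict`: when its right side vanishes, a non-zero term for the whole
group forces a non-zero term for a proper supplement, and induction on the order applies. Hence
`e_A` consists of the groups above `A`, and `e⁰_A` of those above some `B_K`-group strictly above
`A`.

Now `e⁰_A` does not contain `A`, while every ideal inside `e_A` that misses `A` lies in `e⁰_A`
(`le_ideal₀`). This gives simplicity. The idempotent of `A` acts non-trivially on `S_A`, and its
acting non-trivially on `S_B` forces `A` to surject onto `B`; by symmetry isomorphic simple modules
come from isomorphic groups. For a simple `I / I'`, a `B_K`-group `A` in `I` and not in `I'`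
satisfies `e_A + I' = I` and `e_A ∩ I' = e⁰_A`, and the second isomorphism theorem identifies `I /
I'` with `S_A`. -/

namespace RelBGroup

open MulOpposite
open scoped Classical

noncomputable section

/-! ## Möbius functions of subgroup lattices -/

/-- The subgroups of a finite group form a finite type. -/
local instance fintypeSubgroup (G : Type u) [Group G] [Finite G] : Fintype (Subgroup G) :=
  Fintype.ofFinite _

section Moebius

variable {G H : Type u} [Group G] [Finite G] [Group H] [Finite H]

theorem moebius_sum_left (X Y : Subgroup G) :
    ∑ Z : Subgroup G, (if X ≤ Z ∧ Z ≤ Y then moebius Z Y else 0) = if X = Y then 1 else 0 := by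
  let _ : LocallyFiniteOrder (Subgroup G) := Fintype.toLocallyFiniteOrder
  rw [← Finset.sum_filter]
  have h := IncidenceAlgebra.sum_Icc_mu_left (𝕜 := ℤ) X Y
  convert h using 2
  · ext Z
    simp
  · rfl

theorem moebius_sum_right (X Y : Subgroup G) :
    ∑ Z : Subgroup G, (if X ≤ Z ∧ Z ≤ Y then moebius X Z else 0) = if X = Y then 1 else 0 := by
  let _ : LocallyFiniteOrder (Subgroup G) := Fintype.toLocallyFiniteOrder
  rw [← Finset.sum_filter]
  have h := IncidenceAlgebra.sum_Icc_mu_right (𝕜 := ℤ) X Y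
  convert h using 2
  · ext Z
    simp
  · rfl

theorem moebius_top_sum (X : Subgroup G) :
    ∑ Z : Subgroup G, (if X ≤ Z then moebius Z ⊤ else 0) = if X = ⊤ then 1 else 0 := by
  simpa using moebius_sum_left X ⊤

theorem moebius_self (X : Subgroup G) : moebius X X = 1 := by
  have h := moebius_sum_left X X
  rw [Finset.sum_eq_single X] at h
  · simpa using h
  · intro Z _ hZ
    rw [if_neg]
    rintro ⟨h1, h2⟩
    exact hZ (le_antisymm h2 h1)
  · simp

/-- Uniqueness of inverses in the incidence algebra: the double sum of `μ(X, W) g(Y)` over `X ≤ W ≤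
Y ≤ Z` is evaluated in both orders. -/
theorem eq_moebius_of_sum (g : Subgroup G → ℤ) (Z : Subgroup G)
    (hg : ∀ X, ∑ Y : Subgroup G, (if X ≤ Y ∧ Y ≤ Z then g Y else 0) = if X = Z then 1 else 0)
    {X : Subgroup G} (hX : X ≤ Z) : g X = moebius X Z := by
  have h1 : ∑ W : Subgroup G, ∑ Y : Subgroup G,
      (if X ≤ W then moebius X W else 0) * (if W ≤ Y ∧ Y ≤ Z then g Y else 0) = moebius X Z := by
    simp_rw [← Finset.mul_sum, hg]
    simp [hX]
  rw [← h1, Finset.sum_comm]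
  have h2 : ∀ Y : Subgroup G, ∑ W : Subgroup G,
      (if X ≤ W then moebius X W else 0) * (if W ≤ Y ∧ Y ≤ Z then g Y else 0) =
      (if X = Y then g Y else 0) := by
    intro Y
    have h3 := congrArg (fun n => n * (if Y ≤ Z then g Y else 0)) (moebius_sum_right X Y)
    simp only [Finset.sum_mul] at h3
    calc _ = _ := Finset.sum_congr rfl fun W _ => by
          by_cases hXW : X ≤ W <;> by_cases hWY : W ≤ Y <;> by_cases hYZ : Y ≤ Z <;>
            simp [hXW, hWY, hYZ]
      _ = _ := h3
      _ = _ := by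
        by_cases hXY : X = Y
        · subst hXY
          simp [hX]
        · simp [hXY]
  rw [Finset.sum_congr rfl fun Y _ => h2 Y]
  simp

/-- Order embeddings with convex image preserve the Möbius function. -/
theorem moebius_embedding (f : Subgroup G ↪o Subgroup H)
    (hf : ∀ X Z W, f X ≤ W → W ≤ f Z → ∃ Y, f Y = W) {X Z : Subgroup G} (hX : X ≤ Z) :
    moebius (f X) (f Z) = moebius X Z := by
  refine eq_moebius_of_sum (fun Y => moebius (f Y) (f Z)) Z (fun X => ?_) hX
  have h := moebius_sum_left (f X) (f Z)
  rw [f.injective.eq_iff] at h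
  rw [← h]
  refine Finset.sum_of_injOn f f.injective.injOn (by simp) ?_ ?_
  · intro W _ hW
    rw [if_neg]
    rintro ⟨h1, h2⟩
    obtain ⟨Y, rfl⟩ := hf X Z W h1 h2
    exact hW (by simp)
  · intro Y _
    simp

theorem moebius_map_subtype (X : Subgroup G) (Y : Subgroup X) :
    moebius (Y.map X.subtype) X = moebius Y ⊤ := by
  let f : Subgroup X ↪o Subgroup G :=
    OrderEmbedding.ofMapLEIff (fun Y => Y.map X.subtype)
      (fun Y Z => Subgroup.map_le_map_iff_of_injective X.subtype_injective)
  have h := moebius_embedding f (X := Y) (Z := ⊤) ?_ le_top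
  · simpa [f, ← MonoidHom.range_eq_map] using h
  · intro Y Z W _ hW
    refine ⟨W.subgroupOf X, ?_⟩
    have hWX : W ≤ X := hW.trans (Subgroup.map_subtype_le Z)
    simpa [f] using Subgroup.map_subgroupOf_eq_of_le hWX

theorem moebius_comap {f : G →* H} (hf : Function.Surjective f) (Y : Subgroup H) :
    moebius (Y.comap f) ⊤ = moebius Y ⊤ := by
  let e : Subgroup H ↪o Subgroup G :=
    OrderEmbedding.ofMapLEIff (fun Y => Y.comap f)
      (fun Y Z => Subgroup.comap_le_comap_of_surjective hf)
  have h := moebius_embedding e (X := Y) (Z := ⊤) ?_ le_top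
  · simpa [e] using h
  · intro Y Z W hW _
    refine ⟨W.map f, ?_⟩
    exact Subgroup.comap_map_eq_self ((MonoidHom.ker_le_comap f Y).trans hW)

theorem sum_subgroups_le {M : Type*} [AddCommMonoid M] (X : Subgroup G) (g : Subgroup G → M) :
    ∑ Y : Subgroup G, (if Y ≤ X then g Y else 0) = ∑ Y : Subgroup X, g (Y.map X.subtype) := by
  symm
  refine Finset.sum_of_injOn (fun Y => Y.map X.subtype)
    (Subgroup.map_injective X.subtype_injective).injOn (by simp) ?_ ?_
  · intro W _ hW
    rw [if_neg]
    intro h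
    exact hW ⟨W.subgroupOf X, by simp, Subgroup.map_subgroupOf_eq_of_le h⟩
  · intro Y _
    rw [if_pos (Subgroup.map_subtype_le Y)]

theorem sum_subgroups_ge {M : Type*} [AddCommMonoid M] {f : G →* H}
    (hf : Function.Surjective f) (g : Subgroup G → M) :
    ∑ Y : Subgroup G, (if f.ker ≤ Y then g Y else 0) = ∑ Y : Subgroup H, g (Y.comap f) := by
  symm
  refine Finset.sum_of_injOn (fun Y => Y.comap f)
    (Subgroup.comap_injective hf).injOn (by simp) ?_ ?_
  · intro W _ hW
    rw [if_neg]
    intro h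
    exact hW ⟨W.map f, by simp, Subgroup.comap_map_eq_self h⟩
  · intro Y _
    rw [if_pos (MonoidHom.ker_le_comap f Y)]

/-- Möbius inversion over the subgroups of `Z`. -/
theorem moebius_inversion {M : Type*} [AddCommGroup M] (h : Subgroup G → M) (Z : Subgroup G) :
    ∑ X : Subgroup G, (if X ≤ Z then
      ∑ Y : Subgroup G, (if Y ≤ X then moebius Y X • h Y else 0) else 0) = h Z := by
  have h1 : ∀ X : Subgroup G, (if X ≤ Z then
      ∑ Y : Subgroup G, (if Y ≤ X then moebius Y X • h Y else 0) else 0) =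
      ∑ Y : Subgroup G, (if Y ≤ X ∧ X ≤ Z then moebius Y X else 0) • h Y := by
    intro X
    by_cases hX : X ≤ Z
    · rw [if_pos hX]
      refine Finset.sum_congr rfl fun Y _ => ?_
      simp [hX, ite_smul]
    · simp [hX]
  simp_rw [h1]
  rw [Finset.sum_comm]
  simp_rw [← Finset.sum_smul, moebius_sum_right]
  simp [ite_smul]

/-- A sum against `μ(-, G)` of a function of the intersection with a proper subgroup vanishes. -/
theorem moebius_sum_inf {M : Type*} [AddCommGroup M] (D : Subgroup G) (hD : D ≠ ⊤)
    (h : Subgroup G → M) : ∑ Y : Subgroup G, moebius Y ⊤ • h (Y ⊓ D) = 0 := by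
  -- With `h` written as the sum of `k` over smaller subgroups, the coefficient of `k X`, for `X ≤
  -- D`, is the sum of `μ(Y, ⊤)` over `Y ≥ X`, which vanishes because `X ≠ ⊤`.
  let k : Subgroup G → M :=
    fun X => ∑ Y : Subgroup G, (if Y ≤ X then moebius Y X • h Y else 0)
  have hk : ∀ Y, h (Y ⊓ D) = ∑ X : Subgroup G, (if X ≤ Y ⊓ D then k X else 0) :=
    fun Y => (moebius_inversion h (Y ⊓ D)).symm
  simp_rw [hk, Finset.smul_sum]
  rw [Finset.sum_comm]
  refine Finset.sum_eq_zero fun X _ => ?_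
  by_cases hX : X ≤ D
  · have : ∀ Y : Subgroup G, moebius Y ⊤ • (if X ≤ Y ⊓ D then k X else 0) =
        (if X ≤ Y then moebius Y ⊤ else 0) • k X := by
      intro Y
      by_cases hY : X ≤ Y <;> simp [hX, hY]
    simp_rw [this]
    rw [← Finset.sum_smul, moebius_top_sum, if_neg, zero_smul]
    rintro rfl
    exact hD (top_le_iff.1 hX)
  · simp [hX]

omit [Finite G] [Finite H] in
theorem map_eq_top_iff {f : G →* H} (hf : Function.Surjective f) (X : Subgroup G) :
    X.map f = ⊤ ↔ X ⊔ f.ker = ⊤ := by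
  rw [← Subgroup.comap_map_eq]
  constructor
  · intro h
    rw [h, Subgroup.comap_top]
  · intro h
    rw [← top_le_iff, ← Subgroup.comap_le_comap_of_surjective hf, h]
    exact le_top

/-! ### The constants `m_{L,N}` -/

/-- The integer `|L| m_{L,N}`. -/
def tConst (N : Subgroup G) : ℤ :=
  ∑ X : Subgroup G, if X ⊔ N = ⊤ then (Nat.card X : ℤ) * moebius X ⊤ else 0

theorem mConst_eq (N : Subgroup G) : mConst N = (Nat.card G : ℚ)⁻¹ * (tConst N : ℚ) := by
  unfold mConst tConst
  congr 1
  rw [finsum_eq_sum_of_fintype]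
  push_cast
  refine Finset.sum_congr rfl fun X _ => ?_
  rw [finsum_eq_if]

theorem mConst_eq_zero_iff (N : Subgroup G) : mConst N = 0 ↔ tConst N = 0 := by
  rw [mConst_eq]
  simp [Nat.card_ne_zero.2 ⟨⟨(1 : G)⟩, inferInstance⟩]

theorem tConst_bot : tConst (⊥ : Subgroup G) = Nat.card G := by
  unfold tConst
  simp [moebius_self]

omit [Finite H] in
theorem tConst_ker {f : G →* H} (hf : Function.Surjective f) :
    tConst f.ker =
      ∑ X : Subgroup G, if X.map f = ⊤ then (Nat.card X : ℤ) * moebius X ⊤ else 0 := by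
  unfold tConst
  refine Finset.sum_congr rfl fun X _ => ?_
  congr 1
  rw [map_eq_top_iff hf]

/-- The sum of the `tConst` of the restrictions of `g` to the supplements of `ker f`. -/
theorem sum_tConst_restrict {B : Type u} [Group B] [Finite B] {f : G →* H} {g : G →* B}
    (hf : Function.Surjective f) (hg : Function.Surjective g) :
    ∑ X : Subgroup G, (if X.map f = ⊤ then
      ∑ Y : Subgroup X, (if (Y.map X.subtype).map g = ⊤ then
        (Nat.card Y : ℤ) * moebius Y ⊤ else 0) else 0) =
      Nat.card f.ker * tConst (g.ker.map f) := by
  -- The inner sums are the Möbius transform `s` of `a`, so summing `s` over all subgroups of a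
  -- given `Z` returns `a Z`.
  let a : Subgroup G → ℤ := fun Z => if Z.map g = ⊤ then (Nat.card Z : ℤ) else 0
  let s : Subgroup G → ℤ := fun X => ∑ Y : Subgroup G, if Y ≤ X then moebius Y X • a Y else 0
  have hs : ∀ X : Subgroup G, (∑ Y : Subgroup X, if (Y.map X.subtype).map g = ⊤ then
        (Nat.card Y : ℤ) * moebius Y ⊤ else 0) = s X := by
    intro X
    simp only [s]
    rw [sum_subgroups_le X (fun Y => moebius Y X • a Y)]
    refine Finset.sum_congr rfl fun Y _ => ?_
    simp only [a]
    rw [moebius_map_subtype, Subgroup.card_map_of_injective X.subtype_injective]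
    split_ifs <;> simp [mul_comm]
  simp_rw [hs]
  -- The condition that `X` supplements `ker f` is expanded as the sum of `μ(Z, ⊤)` over all `Z`
  -- containing both `X` and `ker f`; this frees the sum over `X ≤ Z`.
  have h1 : ∀ X : Subgroup G, (if X.map f = ⊤ then s X else 0) =
      ∑ Z : Subgroup G, (if f.ker ≤ Z then moebius Z ⊤ * (if X ≤ Z then s X else 0) else 0) := by
    intro X
    have h2 := congrArg (fun n => n * s X) (moebius_top_sum (X ⊔ f.ker))
    simp only [Finset.sum_mul] at h2
    calc _ = _ := by
          rw [map_eq_top_iff hf]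
          split_ifs <;> simp
      _ = _ := h2.symm
      _ = _ := Finset.sum_congr rfl fun Z _ => by
        by_cases hx : X ≤ Z <;> by_cases hz : f.ker ≤ Z <;> simp [hx, hz]
  simp_rw [h1]
  rw [Finset.sum_comm]
  have h3 : ∀ Z : Subgroup G, (∑ X : Subgroup G,
      if f.ker ≤ Z then moebius Z ⊤ * (if X ≤ Z then s X else 0) else 0) =
      if f.ker ≤ Z then moebius Z ⊤ * a Z else 0 := by
    intro Z
    split_ifs
    · rw [← Finset.mul_sum, moebius_inversion a Z]
    · simp
  simp_rw [h3]
  -- The remaining `Z` are the preimages of subgroups `Y` of the target of `f`, and the factor `|ker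
  -- f|` is the ratio of the orders of the preimage and `Y`.
  rw [sum_subgroups_ge hf (fun Z => moebius Z ⊤ * a Z)]
  unfold tConst
  rw [Finset.mul_sum]
  refine Finset.sum_congr rfl fun Y _ => ?_
  rw [moebius_comap hf]
  have h4 : ((Y.comap f).map g = ⊤) ↔ Y ⊔ g.ker.map f = ⊤ := by
    have h5 : Y.comap f ⊔ g.ker = (Y ⊔ g.ker.map f).comap f := by
      rw [← Subgroup.comap_sup_eq f _ _ hf, Subgroup.comap_map_eq, sup_comm g.ker, ← sup_assoc,
        sup_eq_left.2 (MonoidHom.ker_le_comap f Y)]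
    rw [map_eq_top_iff hg, h5]
    constructor
    · intro h
      rw [← top_le_iff, ← Subgroup.comap_le_comap_of_surjective hf, h]
      exact le_top
    · intro h
      rw [h, Subgroup.comap_top]
  have h6 : Nat.card (Y.comap f) = Nat.card f.ker * Nat.card Y := by
    have e1 := Subgroup.card_mul_index (Y.comap f)
    have e2 := Subgroup.card_mul_index Y
    have e3 := Subgroup.card_mul_index f.ker
    rw [Subgroup.index_comap_of_surjective Y hf] at e1
    rw [Subgroup.index_ker, MonoidHom.range_eq_top.2 hf, Subgroup.card_top] at e3
    have e4 : 0 < Y.index := Nat.pos_of_ne_zero Subgroup.index_ne_zero_of_finite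
    refine Nat.eq_of_mul_eq_mul_right e4 ?_
    rw [e1, mul_assoc, e2, e3]
  simp only [a, h4, h6]
  split_ifs
  · push_cast; ring
  · simp

end Moebius

/-! ## Marks on Burnside algebras -/

namespace FB

variable {F : Type v} [Field F] {G H L : Type u} [Group G] [Group H] [Group L]

/-- The mark `[X] ↦ |X^Z|`. -/
def mark (Z : Subgroup G) : FB F G →ₗ[F] F :=
  lift (fun X => (Nat.card {x : X.carrier // ∀ g ∈ Z, g • x = x} : F))
    (fun X Y ⟨e, he⟩ => by
      congr 1
      refine Nat.card_congr (e.subtypeEquiv fun x => forall₂_congr fun g _ => ?_)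
      rw [← he, e.injective.eq_iff])
    (fun X Y => by
      rw [← Nat.cast_add, ← Nat.card_sum]
      congr 1
      refine Nat.card_congr ((Equiv.subtypeSum (α := X.carrier) (β := Y.carrier)).trans
        (Equiv.sumCongr (Equiv.subtypeEquivRight fun x => ?_)
          (Equiv.subtypeEquivRight fun x => ?_)))
      · exact forall₂_congr fun g _ => Sum.inl_injective.eq_iff
      · exact forall₂_congr fun g _ => Sum.inr_injective.eq_iff)

theorem mark_of (Z : Subgroup G) (X : GSet G) :
    mark Z (of F X) = (Nat.card {x : X.carrier // ∀ g ∈ Z, g • x = x} : F) :=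
  lift_of _ _ _ X

theorem mark_res (f : G →* H) (Z : Subgroup G) (a : FB F H) :
    mark Z (res f a) = mark (Z.map f) a := by
  refine LinearMap.congr_fun (f := (mark Z).comp (res f)) (g := mark (Z.map f)) ?_ a
  refine hom_ext fun X => ?_
  rw [LinearMap.comp_apply, res_of, mark_of, mark_of]
  congr 1
  refine Nat.card_congr (Equiv.subtypeEquivRight fun x => ?_)
  constructor
  · rintro h _ ⟨g, hg, rfl⟩
    exact h g hg
  · intro h g hg
    exact h (f g) ⟨g, hg, rfl⟩

theorem mark_ext (Z : Subgroup (G × H)) (a : FB F G) (b : FB F H) :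
    mark Z (ext a b) =
      mark (Z.map (MonoidHom.fst G H)) a * mark (Z.map (MonoidHom.snd G H)) b := by
  induction a using induction with
  | h0 => simp
  | hadd a a' h h' => simp only [map_add, LinearMap.add_apply, h, h', add_mul]
  | hsmul c a h => simp only [map_smul, LinearMap.smul_apply, h, smul_eq_mul, mul_assoc]
  | hof X =>
  induction b using induction with
  | h0 => simp
  | hadd a a' h h' => simp only [map_add, h, h', mul_add]
  | hsmul c a h => simp only [map_smul, h, smul_eq_mul, mul_left_comm]
  | hof Y =>
  rw [ext_of, mark_of, mark_of, mark_of, ← Nat.cast_mul, ← Nat.card_prod]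
  congr 1
  refine Nat.card_congr (Equiv.trans (Equiv.subtypeEquivRight fun p => ?_)
    (Equiv.subtypeProdEquivProd (α := X.carrier) (β := Y.carrier)))
  constructor
  · intro h
    refine ⟨?_, ?_⟩
    · rintro _ ⟨g, hg, rfl⟩
      exact congrArg Prod.fst (h g hg)
    · rintro _ ⟨g, hg, rfl⟩
      exact congrArg Prod.snd (h g hg)
  · rintro ⟨h1, h2⟩ g hg
    exact Prod.ext (h1 _ ⟨g, hg, rfl⟩) (h2 _ ⟨g, hg, rfl⟩)

theorem mark_conj (g : G) {Z Z' : Subgroup G} (h : ∀ x, x ∈ Z ↔ g * x * g⁻¹ ∈ Z')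
    (a : FB F G) : mark Z a = mark Z' a := by
  refine LinearMap.congr_fun (f := mark Z) (g := mark Z') (hom_ext fun X => ?_) a
  rw [mark_of, mark_of]
  congr 1
  refine Nat.card_congr ((MulAction.toPerm g).subtypeEquiv fun x => ?_)
  constructor
  · intro hx z hz
    have h1 : g⁻¹ * z * g ∈ Z := by
      rw [h]
      simpa [mul_assoc] using hz
    have h2 := hx _ h1
    rw [mul_smul, mul_smul, inv_smul_eq_iff] at h2
    exact h2
  · intro hx z hz
    have h2 := hx _ ((h z).1 hz)
    rw [MulAction.toPerm_apply, mul_smul, inv_smul_smul, mul_smul] at h2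
    exact MulAction.injective g h2

/-! ### Orbit decomposition -/

theorem of_eq_zero (X : GSet G) [IsEmpty X.carrier] : of F X = 0 := by
  have h : (X.sum X).IsIso X := by
    have : IsEmpty (X.sum X).carrier := inferInstanceAs (IsEmpty (X.carrier ⊕ X.carrier))
    exact ⟨Equiv.equivOfIsEmpty _ _, fun g x => isEmptyElim x⟩
  have h2 := (of_sum (F := F) X X).symm.trans (of_eq_of_isIso h)
  simpa using h2

/-- An invariant subset of a `G`-set. -/
def _root_.RelBGroup.GSet.sub (X : GSet G) (s : Set X.carrier)
    (hs : ∀ (g : G), ∀ x ∈ s, g • x ∈ s) : GSet G where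
  carrier := s
  action :=
    { smul := fun g x => ⟨g • x.1, hs g x.1 x.2⟩
      one_smul := fun x => Subtype.ext (one_smul G x.1)
      mul_smul := fun g g' x => Subtype.ext (mul_smul g g' x.1) }

theorem of_eq_sub_add (X : GSet G) (s : Set X.carrier) (hs : ∀ (g : G), ∀ x ∈ s, g • x ∈ s)
    (hs' : ∀ (g : G), ∀ x ∈ sᶜ, g • x ∈ sᶜ) :
    of F X = of F (X.sub s hs) + of F (X.sub sᶜ hs') := by
  rw [← of_sum]
  symm
  apply of_eq_of_isIso
  refine ⟨Equiv.Set.sumCompl s, ?_⟩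
  rintro g (x | x) <;> rfl

theorem of_eq_coset [Finite G] (X : GSet G) (x : X.carrier)
    (hx : ∀ y, ∃ g : G, g • x = y) : of F X = of F (GSet.coset (MulAction.stabilizer G x)) := by
  symm
  apply of_eq_of_isIso
  refine GSet.IsIso.of_bijective
    (X := GSet.coset (MulAction.stabilizer G x)) (MulAction.ofQuotientStabilizer G x)
    ⟨MulAction.injective_ofQuotientStabilizer G x, ?_⟩ ?_
  · intro y
    obtain ⟨g, rfl⟩ := hx y
    exact ⟨(g : G ⧸ MulAction.stabilizer G x), rfl⟩
  · exact fun g t => MulAction.ofQuotientStabilizer_smul G x g t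

/-- The orbit decomposition, with each orbit counted once for each of its points. -/
theorem card_smul_of [Finite G] (X : GSet G) : (Nat.card G : F) • of F X =
    ∑ᶠ x : X.carrier, (Nat.card (MulAction.stabilizer G x) : F) •
      of F (GSet.coset (MulAction.stabilizer G x)) := by
  induction h : Nat.card X.carrier using Nat.strong_induction_on generalizing X with
  | h n ih =>
  subst h
  rcases isEmpty_or_nonempty X.carrier with hX | ⟨⟨x⟩⟩
  · rw [of_eq_zero, smul_zero, finsum_of_isEmpty]
  let s : Set X.carrier := MulAction.orbit G x
  have hs : ∀ (g : G), ∀ y ∈ s, g • y ∈ s := by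
    rintro g _ ⟨g', rfl⟩
    exact ⟨g * g', mul_smul g g' x⟩
  have hs' : ∀ (g : G), ∀ y ∈ sᶜ, g • y ∈ sᶜ := fun g y hy hgy => hy (by
    simpa using hs g⁻¹ _ hgy)
  have hlt : Nat.card (X.sub sᶜ hs').carrier < Nat.card X.carrier := by
    refine Finite.card_subtype_lt (x := x) ?_
    simp [s]
  have e2 := ih _ hlt (X.sub sᶜ hs') rfl
  have hst : ∀ (t : Set X.carrier) (ht : ∀ (g : G), ∀ y ∈ t, g • y ∈ t)
      (y : (X.sub t ht).carrier),
      MulAction.stabilizer G y = MulAction.stabilizer G (y.1 : X.carrier) := by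
    intro t ht y
    ext g
    exact Subtype.ext_iff
  have htrans : ∀ y z : (X.sub s hs).carrier, ∃ g : G, g • y = z := by
    intro y z
    obtain ⟨g, hg⟩ := MulAction.orbit_eq_iff.1
      ((MulAction.orbit_eq_iff.2 z.2).trans (MulAction.orbit_eq_iff.2 y.2).symm)
    exact ⟨g, Subtype.ext hg⟩
  have hcard : ∀ y : s, Nat.card s * Nat.card (MulAction.stabilizer G y.1) = Nat.card G := by
    intro y
    have h1 : MulAction.orbit G y.1 = s := MulAction.orbit_eq_iff.2 y.2
    rw [← Subgroup.card_mul_index (MulAction.stabilizer G y.1), MulAction.index_stabilizer, h1,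
      mul_comm]
    rfl
  have hpos : 0 < Nat.card s :=
    Nat.card_pos_iff.2 ⟨⟨⟨x, MulAction.mem_orbit_self x⟩⟩, inferInstance⟩
  have e1 : (Nat.card G : F) • of F (X.sub s hs) =
      ∑ᶠ y : s, (Nat.card (MulAction.stabilizer G y.1) : F) •
        of F (GSet.coset (MulAction.stabilizer G y.1)) := by
    -- All points of one orbit contribute the same term, and the orbit length times the stabilizer
    -- order is `|G|`.
    have hy : ∀ y : s, (Nat.card (MulAction.stabilizer G y.1) : F) •
        of F (GSet.coset (MulAction.stabilizer G y.1)) =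
        (Nat.card (MulAction.stabilizer G x) : F) • of F (X.sub s hs) := by
      intro y
      rw [of_eq_coset (X.sub s hs) y (htrans y), hst s hs y,
        Nat.eq_of_mul_eq_mul_left hpos
          ((hcard y).trans (hcard ⟨x, MulAction.mem_orbit_self x⟩).symm)]
    let _ : Fintype s := Fintype.ofFinite _
    rw [finsum_congr hy, finsum_eq_sum_of_fintype, Finset.sum_const, Finset.card_univ,
      ← Nat.card_eq_fintype_card, ← Nat.cast_smul_eq_nsmul F, smul_smul, ← Nat.cast_mul,
      hcard ⟨x, MulAction.mem_orbit_self x⟩]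
  rw [of_eq_sub_add X s hs hs', smul_add, e1, e2,
    ← finsum_comp_equiv (Equiv.Set.sumCompl s)]
  let _ : Fintype X.carrier := Fintype.ofFinite _
  let _ : Fintype (X.sub sᶜ hs').carrier := inferInstanceAs (Fintype (sᶜ : Set X.carrier))
  rw [finsum_eq_sum_of_fintype, finsum_eq_sum_of_fintype, finsum_eq_sum_of_fintype,
    Fintype.sum_sum_type]
  congr 1
  refine Finset.sum_congr rfl fun y _ => ?_
  rw [hst sᶜ hs' y]
  rfl

/-! ### Marks of the image of a transitive set -/

/-- `U ×_G (G / Y)` is the set of `Y`-orbits on `U`. Replacing each orbit by its points, weighted by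
their stabilizers in `Y`, counts it `|Y|` times, which avoids choosing representatives. -/
theorem card_mul_mark_map [Finite G] (U : Biset H G) (Z : Subgroup H) (Y : Subgroup G) :
    (Nat.card Y : F) * mark Z (map U (of F (GSet.coset Y))) =
      ∑ᶠ u : U.carrier, if ∀ z ∈ Z, ∃ y ∈ Y, op y • u = z • u then
        (Nat.card {y : Y // op (y : G) • u = u} : F) else 0 := by
  let _ : Fintype U.carrier := Fintype.ofFinite _
  let _ : Fintype (U.Tensor (G ⧸ Y)) := Fintype.ofFinite _
  have hfix : ∀ u : U.carrier, (∀ z ∈ Z, z • U.tmk u ((1 : G) : G ⧸ Y) = U.tmk u ((1 : G) : G ⧸ Y))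
      ↔ ∀ z ∈ Z, ∃ y ∈ Y, op y • u = z • u := by
    intro u
    refine forall₂_congr fun z _ => ?_
    rw [Biset.smul_tmk, eq_comm, Biset.tmk_eq_iff]
    refine exists_congr fun g => ?_
    rw [and_comm, eq_comm (b := op g • u)]
    refine and_congr_left fun _ => ?_
    rw [eq_comm, MulAction.Quotient.smul_coe, QuotientGroup.eq]
    simp
  have hsurj : ∀ t : U.Tensor (G ⧸ Y), ∃ u, U.tmk u ((1 : G) : G ⧸ Y) = t := by
    intro t
    obtain ⟨u, x, rfl⟩ := U.exists_tmk t
    obtain ⟨g, rfl⟩ := QuotientGroup.mk_surjective x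
    refine ⟨op g • u, ?_⟩
    rw [Biset.tmk_op_smul, MulAction.Quotient.smul_coe]
    simp
  -- The elements of `Y` carrying `u₀` to `u`, if there are any, form a coset of the stabilizer of
  -- `u`.
  have hfib : ∀ u₀ u : U.carrier,
      (if U.tmk u ((1 : G) : G ⧸ Y) = U.tmk u₀ ((1 : G) : G ⧸ Y) then
        Nat.card {y : Y // op (y : G) • u = u} else 0) =
        Nat.card {y : Y // op (y : G) • u₀ = u} := by
    intro u₀ u
    have h1 : U.tmk u₀ ((1 : G) : G ⧸ Y) = U.tmk u ((1 : G) : G ⧸ Y) ↔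
        ∃ y : Y, op (y : G) • u₀ = u := by
      rw [Biset.tmk_eq_iff, Subtype.exists]
      refine exists_congr fun g => ?_
      rw [and_comm, eq_comm (b := op g • u₀), exists_prop (b := op g • u₀ = u), and_comm,
        and_comm (a := g ∈ Y)]
      refine and_congr_right fun _ => ?_
      rw [eq_comm, MulAction.Quotient.smul_coe, QuotientGroup.eq]
      simp
    rw [eq_comm (b := U.tmk u₀ _), h1]
    split_ifs with h
    · obtain ⟨y₀, rfl⟩ := h
      refine Nat.card_congr ((Equiv.mulLeft y₀).subtypeEquiv fun y => ?_)
      simp [mul_smul]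
    · symm
      rw [Finite.card_eq_zero_iff]
      exact ⟨fun y => h ⟨y.1, y.2⟩⟩
  have hsum : ∀ u₀ : U.carrier,
      ∑ u : U.carrier, Nat.card {y : Y // op (y : G) • u₀ = u} = Nat.card Y := by
    intro u₀
    rw [← Nat.card_sigma]
    exact Nat.card_congr (Equiv.sigmaFiberEquiv fun y : Y => op (y : G) • u₀)
  have hmark : mark Z (map U (of F (GSet.coset Y))) =
      ∑ t : U.Tensor (G ⧸ Y), if ∀ z ∈ Z, z • t = t then (1 : F) else 0 := by
    rw [map_of, mark_of, Finset.sum_boole, ← Fintype.card_subtype, ← Nat.card_eq_fintype_card]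
    rfl
  rw [hmark, finsum_eq_sum_of_fintype, Finset.mul_sum]
  calc _ = ∑ t : U.Tensor (G ⧸ Y), ∑ u : U.carrier,
        if U.tmk u ((1 : G) : G ⧸ Y) = t then
          (if ∀ z ∈ Z, z • t = t then (Nat.card {y : Y // op (y : G) • u = u} : F) else 0)
          else 0 := by
        refine Finset.sum_congr rfl fun t _ => ?_
        obtain ⟨u₀, rfl⟩ := hsurj t
        by_cases hz : ∀ z ∈ Z, z • U.tmk u₀ ((1 : G) : G ⧸ Y) = U.tmk u₀ ((1 : G) : G ⧸ Y)
        · simp only [if_pos hz]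
          rw [mul_one, ← hsum u₀, Nat.cast_sum]
          refine Finset.sum_congr rfl fun u _ => ?_
          rw [← hfib, Nat.cast_ite, Nat.cast_zero]
        · simp only [if_neg hz]
          simp
    _ = _ := by
        rw [Finset.sum_comm]
        refine Finset.sum_congr rfl fun u _ => ?_
        rw [Finset.sum_ite_eq, if_pos (Finset.mem_univ _)]
        simp only [hfix]

end FB

/-! ## The idempotents and the action of bisets on them -/

namespace Biset

variable {G H L : Type u} [Group G] [Group H] [Group L]

/-- The stabilizer of `u` for the right action of `L` through `f`. -/
def rstab (U : Biset H G) (f : L →* G) (u : U.carrier) : Subgroup L where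
  carrier := {l | op (f l) • u = u}
  one_mem' := by simp
  mul_mem' {a b} ha hb := by
    simp only [Set.mem_ofPred_eq] at ha hb ⊢
    rw [map_mul, op_mul, mul_smul, ha, hb]
  inv_mem' {a} ha := by
    simp only [Set.mem_ofPred_eq] at ha ⊢
    rw [map_inv, op_inv, inv_smul_eq_iff, ha]

theorem mem_rstab {U : Biset H G} {f : L →* G} {u : U.carrier} {l : L} :
    l ∈ U.rstab f u ↔ op (f l) • u = u := Iff.rfl

/-- `Z u = u L`. -/
def Linked (U : Biset H G) (Z : Subgroup H) (f : L →* G) (u : U.carrier) : Prop :=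
  (∀ z ∈ Z, ∃ l, op (f l) • u = z • u) ∧ ∀ l, ∃ z ∈ Z, op (f l) • u = z • u

/-- The elements `l` of `L` such that `u l` is in `Z u`. -/
def transporter (U : Biset H G) (Z : Subgroup H) (f : L →* G) (u : U.carrier) : Subgroup L where
  carrier := {l | ∃ z ∈ Z, op (f l) • u = z • u}
  one_mem' := ⟨1, Z.one_mem, by simp⟩
  mul_mem' {a b} := by
    rintro ⟨z, hz, ha⟩ ⟨w, hw, hb⟩
    refine ⟨z * w, Z.mul_mem hz hw, ?_⟩
    rw [map_mul, op_mul, mul_smul, ha, ← smul_comm z, hb, mul_smul]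
  inv_mem' {a} := by
    rintro ⟨z, hz, ha⟩
    refine ⟨z⁻¹, Z.inv_mem hz, ?_⟩
    rw [map_inv, op_inv, inv_smul_eq_iff, ← smul_comm, ha, inv_smul_smul]

variable [Finite L]

omit [Finite L] in
theorem rstab_normal {U : Biset H G} {Z : Subgroup H} {f : L →* G} {u : U.carrier}
    (h : U.Linked Z f u) : (U.rstab f u).Normal := by
  refine ⟨fun n hn l => ?_⟩
  rw [mem_rstab] at hn ⊢
  obtain ⟨z, -, hz⟩ := h.2 l
  rw [map_mul, map_mul, map_inv, op_mul, op_mul, mul_smul, mul_smul, hz, ← smul_comm z, hn, ← hz,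
    op_inv, inv_smul_smul]

omit [Finite L] in
theorem card_mul_card_inf_of_sup_eq_top {Y N : Subgroup L} [N.Normal] (h : Y ⊔ N = ⊤) :
    Nat.card L * Nat.card (Y ⊓ N : Subgroup L) = Nat.card Y * Nat.card N := by
  have h1 : N.index = N.relIndex Y := by
    rw [← Subgroup.relIndex_sup_right, h, Subgroup.relIndex_top_right]
  have h2 := Subgroup.card_mul_index N
  have h3 : Nat.card (N.subgroupOf Y) * N.relIndex Y = Nat.card Y :=
    Subgroup.card_mul_index (N.subgroupOf Y)
  have h4 : Nat.card (Y ⊓ N : Subgroup L) = Nat.card (N.subgroupOf Y) := by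
    rw [inf_comm, ← Subgroup.subgroupOf_map_subtype,
      Subgroup.card_map_of_injective Y.subtype_injective]
  rw [h4, ← h2, ← h3, h1]
  ring

/-- The summand depends only on the intersection of `Y` with the transporter, so `moebius_sum_inf`
kills the sum unless the transporter is all of `L`. When `u` is linked, the condition on `Y` becomes
`Y N = L` for `N` the stabilizer, and `|L| |Y ∩ N| = |Y| |N|` produces `tConst N`. -/
theorem sum_moebius_linked (U : Biset H G) (Z : Subgroup H) (f : L →* G) (u : U.carrier) :
    (Nat.card L : ℤ) * ∑ Y : Subgroup L, moebius Y ⊤ *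
      (if ∀ z ∈ Z, ∃ l ∈ Y, op (f l) • u = z • u then
        (Nat.card (Y ⊓ U.rstab f u : Subgroup L) : ℤ) else 0) =
      if U.Linked Z f u then (Nat.card (U.rstab f u) : ℤ) * tConst (U.rstab f u) else 0 := by
  let h : Subgroup L → ℤ := fun Y => if ∀ z ∈ Z, ∃ l ∈ Y, op (f l) • u = z • u then
        (Nat.card (Y ⊓ U.rstab f u : Subgroup L) : ℤ) else 0
  let D := U.transporter Z f u
  -- A witness `l` with `u l = z u` lies in the transporter by definition, and so does the
  -- stabilizer of `u` (take `z = 1`).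
  have hD : ∀ Y, h Y = h (Y ⊓ D) := by
    intro Y
    have h1 : U.rstab f u ≤ D := fun l hl => ⟨1, Z.one_mem, by rw [one_smul]; exact hl⟩
    have h2 : (Y ⊓ D) ⊓ U.rstab f u = Y ⊓ U.rstab f u := by
      rw [inf_assoc, inf_eq_right.2 h1]
    simp only [h, h2]
    congr 1
    rw [eq_iff_iff]
    refine forall₂_congr fun z hz => exists_congr fun l => ?_
    rw [Subgroup.mem_inf, and_assoc]
    exact and_congr_right fun _ => ⟨fun e => ⟨⟨z, hz, e⟩, e⟩, fun e => e.2⟩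
  by_cases hDt : D = ⊤
  · by_cases hZ : ∀ z ∈ Z, ∃ l, op (f l) • u = z • u
    · have hl : U.Linked Z f u := ⟨hZ, fun l => show l ∈ D from hDt ▸ Subgroup.mem_top l⟩
      have hN := U.rstab_normal hl
      rw [if_pos hl, tConst, Finset.mul_sum, Finset.mul_sum]
      refine Finset.sum_congr rfl fun Y _ => ?_
      have hY : (∀ z ∈ Z, ∃ l ∈ Y, op (f l) • u = z • u) ↔ Y ⊔ U.rstab f u = ⊤ := by
        constructor
        · intro hY
          rw [eq_top_iff]
          intro l _
          obtain ⟨z, hz, hlz⟩ := hl.2 l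
          obtain ⟨y, hy, hyz⟩ := hY z hz
          have hn : l * y⁻¹ ∈ U.rstab f u := by
            rw [mem_rstab, map_mul, op_mul, mul_smul, hlz, ← hyz, map_inv, op_inv, inv_smul_smul]
          have := Subgroup.mul_mem_sup hn hy
          rw [sup_comm]
          simpa using this
        · intro hY z hz
          obtain ⟨l, hlz⟩ := hZ z hz
          have hlt : l ∈ U.rstab f u ⊔ Y := by
            rw [sup_comm, hY]
            exact Subgroup.mem_top l
          obtain ⟨n, hn, y, hy, rfl⟩ := Subgroup.mem_sup_of_normal_left.1 hlt
          refine ⟨y, hy, ?_⟩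
          rw [mem_rstab] at hn
          rw [← hlz, map_mul, op_mul, mul_smul, hn]
      simp only [hY]
      split_ifs with hYt
      · have := congrArg (fun n : ℕ => (n : ℤ)) (card_mul_card_inf_of_sup_eq_top hYt)
        push_cast at this
        linear_combination moebius Y ⊤ * this
      · simp
    · rw [if_neg fun hl => hZ hl.1, Finset.sum_eq_zero, mul_zero]
      intro Y _
      rw [if_neg, mul_zero]
      exact fun hY => hZ fun z hz => (hY z hz).imp fun l hl => hl.2
  · rw [if_neg]
    · have h0 := moebius_sum_inf D hDt h
      simp only [← hD, smul_eq_mul] at h0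
      rw [h0, mul_zero]
    · intro hl
      exact hDt (eq_top_iff.2 fun l _ => hl.2 l)

end Biset

namespace FB

variable {F : Type v} [Field F] {G H L : Type u} [Group G] [Group H] [Group L]
  [Finite G] [Finite H] [Finite L]

/-- For an injective homomorphism `f : L → G`, this is `|N_G(f(L))|` times the idempotent attached
to the subgroup `f(L)`. -/
def gluck (F : Type v) [Field F] (f : L →* G) : FB F G :=
  ∑ Y : Subgroup L, ((Nat.card Y : F) * (moebius Y ⊤ : F)) • of F (GSet.coset (Y.map f))

theorem gluck_subtype (X : Subgroup G) : gluck F X.subtype =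
    ∑ Y : Subgroup G, if Y ≤ X then ((Nat.card Y : F) * (moebius Y X : F)) • of F (GSet.coset Y)
      else 0 := by
  rw [sum_subgroups_le X
    fun Y => ((Nat.card Y : F) * (moebius Y X : F)) • of F (GSet.coset Y)]
  refine Finset.sum_congr rfl fun Y _ => ?_
  rw [moebius_map_subtype, Subgroup.card_map_of_injective X.subtype_injective]

theorem idem_eq (X : Subgroup G) :
    idem F X = (Nat.card (Subgroup.normalizer (X : Set G)) : F)⁻¹ • gluck F X.subtype := by
  unfold idem
  rw [gluck_subtype, finsum_eq_sum_of_fintype]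
  congr 1
  refine Finset.sum_congr rfl fun Y _ => ?_
  rw [finsum_eq_if]

theorem gluck_comp_equiv {L' : Type u} [Group L'] [Finite L'] (f : L →* G) (e : L' ≃* L) :
    gluck F (f.comp e.toMonoidHom) = gluck F f := by
  unfold gluck
  symm
  refine Finset.sum_bij (fun Y _ => Y.comap e.toMonoidHom) (by simp) ?_ ?_ ?_
  · intro Y _ Y' _ h
    exact Subgroup.comap_injective e.surjective h
  · intro Y _
    exact ⟨Y.map e.toMonoidHom, by simp, Subgroup.comap_map_eq_self_of_injective e.injective Y⟩
  · intro Y _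
    rw [moebius_comap e.surjective, ← Subgroup.map_map,
      Subgroup.map_comap_eq_self_of_surjective e.surjective]
    congr 3
    rw [← Subgroup.card_map_of_injective (K := Y.comap e.toMonoidHom)
      (f := e.toMonoidHom) e.injective,
      Subgroup.map_comap_eq_self_of_surjective e.surjective]

theorem gluck_range {f : L →* G} (hf : Function.Injective f) :
    gluck F f.range.subtype = gluck F f := by
  rw [← gluck_comp_equiv f.range.subtype (MonoidHom.ofInjective hf)]
  rfl

omit [Finite H] in
/-- The marks of the image of an idempotent under a biset. -/
theorem card_mul_mark_map_gluck (U : Biset H G) (Z : Subgroup H) {f : L →* G}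
    (hf : Function.Injective f) :
    (Nat.card L : F) * mark Z (map U (gluck F f)) =
      ((∑ᶠ u : U.carrier, if U.Linked Z f u then
        (Nat.card (U.rstab f u) : ℤ) * tConst (U.rstab f u) else 0 : ℤ) : F) := by
  let _ : Fintype U.carrier := Fintype.ofFinite _
  -- Injectivity of `f` identifies the stabilizer of `u` in `f(Y)` with `Y ∩ rstab`, so that all
  -- sums run over subgroups of `L`.
  have h1 : ∀ Y : Subgroup L, (Nat.card Y : F) * mark Z (map U (of F (GSet.coset (Y.map f)))) =
      ((∑ u : U.carrier, if ∀ z ∈ Z, ∃ l ∈ Y, op (f l) • u = z • u then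
        (Nat.card (Y ⊓ U.rstab f u : Subgroup L) : ℤ) else 0 : ℤ) : F) := by
    intro Y
    rw [← Subgroup.card_map_of_injective (K := Y) hf, card_mul_mark_map,
      finsum_eq_sum_of_fintype, Int.cast_sum]
    refine Finset.sum_congr rfl fun u _ => ?_
    rw [Int.cast_ite, Int.cast_zero, Int.cast_natCast]
    have h2 : Nat.card {y : Y.map f // op (y : G) • u = u} =
        Nat.card (Y ⊓ U.rstab f u : Subgroup L) := by
      symm
      refine Nat.card_congr (Equiv.ofBijective
        (fun l : (Y ⊓ U.rstab f u : Subgroup L) =>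
          ⟨⟨f l.1, Subgroup.mem_map_of_mem f l.2.1⟩, l.2.2⟩) ⟨?_, ?_⟩)
      · intro l l' h
        exact Subtype.ext (hf (congrArg (fun x => (x.1.1 : G)) h))
      · rintro ⟨⟨_, l, hl, rfl⟩, h⟩
        exact ⟨⟨l, hl, h⟩, rfl⟩
    rw [h2]
    simp only [Subgroup.mem_map, exists_exists_and_eq_and]
  have h3 : mark Z (map U (gluck F f)) = ((∑ u : U.carrier, ∑ Y : Subgroup L, moebius Y ⊤ *
      (if ∀ z ∈ Z, ∃ l ∈ Y, op (f l) • u = z • u then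
        (Nat.card (Y ⊓ U.rstab f u : Subgroup L) : ℤ) else 0) : ℤ) : F) := by
    rw [gluck, _root_.map_sum, _root_.map_sum, Finset.sum_comm, Int.cast_sum]
    refine Finset.sum_congr rfl fun Y _ => ?_
    rw [map_smul, map_smul, smul_eq_mul, mul_comm (Nat.card Y : F), mul_assoc, h1,
      ← Int.cast_mul, Finset.mul_sum]
  rw [h3, ← Int.cast_natCast, ← Int.cast_mul, Finset.mul_sum, finsum_eq_sum_of_fintype]
  simp only [Biset.sum_moebius_linked]

end FB

/-! ### Expansion in idempotents and non-vanishing of marks. -/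

namespace FB

variable {F : Type v} [Field F] {G H L : Type u} [Group G] [Group H] [Group L]
  [Finite G] [Finite L]

/-- The definition of `gluck` is a Möbius transform of `|Y| [G / Y]`; this is its inversion. -/
theorem card_smul_of_coset (Z : Subgroup G) : (Nat.card Z : F) • of F (GSet.coset Z) =
    ∑ X : Subgroup G, if X ≤ Z then gluck F X.subtype else 0 := by
  rw [← moebius_inversion (fun Y : Subgroup G => (Nat.card Y : F) • of F (GSet.coset Y)) Z]
  refine Finset.sum_congr rfl fun X _ => ?_
  split_ifs
  · rw [gluck_subtype]
    refine Finset.sum_congr rfl fun Y _ => ?_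
    rw [← Int.cast_smul_eq_zsmul F, smul_smul, mul_comm]
  · rfl

/-- Every element of the Burnside algebra is determined by its marks. -/
theorem card_smul_eq_sum (a : FB F G) :
    (Nat.card G : F) • a = ∑ X : Subgroup G, mark X a • gluck F X.subtype := by
  induction a using induction with
  | h0 => simp
  | hadd a a' h h' => simp only [map_add, add_smul, smul_add, h, h', Finset.sum_add_distrib]
  | hsmul c a h =>
    simp only [map_smul, smul_eq_mul, mul_smul, ← Finset.smul_sum, ← h]
    rw [smul_comm]
  | hof X =>
  let _ : Fintype X.carrier := Fintype.ofFinite _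
  rw [card_smul_of, finsum_eq_sum_of_fintype]
  simp_rw [card_smul_of_coset]
  rw [Finset.sum_comm]
  -- After the exchange of sums, the idempotent of `Y` occurs once for each point whose stabilizer
  -- contains `Y`, that is, for each fixed point of `Y`.
  refine Finset.sum_congr rfl fun Y _ => ?_
  rw [mark_of, ← Finset.sum_filter, Finset.sum_const, ← Nat.cast_smul_eq_nsmul F,
    Nat.card_eq_fintype_card, Fintype.card_subtype]
  rfl

variable [CharZero F]

theorem card_ne_zero (F : Type v) [Field F] [CharZero F] (G : Type u) [Group G] [Finite G] :
    (Nat.card G : F) ≠ 0 :=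
  Nat.cast_ne_zero.2 (Nat.card_ne_zero.2 ⟨⟨1⟩, inferInstance⟩)

/-- Characteristic 0 makes `|G|` invertible; this is what lets marks determine an element. -/
theorem eq_sum (a : FB F G) :
    a = (Nat.card G : F)⁻¹ • ∑ X : Subgroup G, mark X a • gluck F X.subtype := by
  rw [← card_smul_eq_sum, inv_smul_smul₀ (card_ne_zero F G)]

theorem mark_injective {a b : FB F G} (h : ∀ X : Subgroup G, mark X a = mark X b) : a = b := by
  rw [eq_sum a, eq_sum b]
  simp only [h]

theorem exists_linked_of_mark_ne_zero {U : Biset H G} {Z : Subgroup H} {f : L →* G}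
    (hf : Function.Injective f) (h : mark Z (map U (gluck F f)) ≠ 0) :
    ∃ u, U.Linked Z f u ∧ tConst (U.rstab f u) ≠ 0 := by
  by_contra! hu
  refine mul_ne_zero (card_ne_zero F L) h ?_
  rw [card_mul_mark_map_gluck U Z hf, finsum_congr (g := fun _ => 0), finsum_zero, Int.cast_zero]
  intro u
  split_ifs with hl
  · rw [hu u hl, mul_zero]
  · rfl

/-- With a common stabilizer `N`, all linked points contribute the same non-zero integer to
`card_mul_mark_map_gluck`, so nothing cancels. -/
theorem mark_ne_zero_of_linked {U : Biset H G} {Z : Subgroup H} {f : L →* G}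
    (hf : Function.Injective f) {N : Subgroup L} (hN : tConst N ≠ 0)
    (hU : ∀ u, U.Linked Z f u → U.rstab f u = N) {u : U.carrier} (hu : U.Linked Z f u) :
    mark Z (map U (gluck F f)) ≠ 0 := by
  intro h
  have h1 := card_mul_mark_map_gluck (F := F) U Z hf
  let _ : Fintype U.carrier := Fintype.ofFinite _
  have h2 : ∀ u : U.carrier, (if U.Linked Z f u then
        (Nat.card (U.rstab f u) : ℤ) * tConst (U.rstab f u) else 0) =
      (if U.Linked Z f u then 1 else 0) * ((Nat.card N : ℤ) * tConst N) := by
    intro u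
    split_ifs with hl
    · rw [hU u hl, one_mul]
    · rw [zero_mul]
  rw [h, mul_zero, finsum_congr h2, finsum_eq_sum_of_fintype, ← Finset.sum_mul, eq_comm,
    Int.cast_eq_zero, mul_eq_zero, mul_eq_zero, Finset.sum_boole] at h1
  rcases h1 with h1 | h1 | h1
  · rw [Nat.cast_eq_zero, Finset.card_eq_zero] at h1
    exact (Finset.eq_empty_iff_forall_notMem.1 h1) u (by simpa using hu)
  · exact Nat.card_ne_zero.2 ⟨⟨(1 : N)⟩, inferInstance⟩ (by exact_mod_cast h1)
  · exact hN h1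

/-- The marks of an idempotent do not vanish exactly at the conjugates of its subgroup. -/
theorem mark_gluck_ne_zero_iff {f : L →* G} (hf : Function.Injective f) {Z : Subgroup G} :
    mark Z (gluck F f) ≠ 0 ↔ ∃ g : G, ∀ x, x ∈ f.range ↔ g * x * g⁻¹ ∈ Z := by
  -- The formula for bisets is applied to the identity biset: a point `g` is linked when conjugation
  -- by `g` carries `f(L)` onto `Z`, and its stabilizer is trivial.
  have hid : mark Z (gluck F f) = mark Z (map (Biset.ident G) (gluck F f)) := by
    rw [map_ident]
    rfl
  have hl : ∀ g : G, (Biset.ident G).Linked Z f g ↔ ∀ x, x ∈ f.range ↔ g * x * g⁻¹ ∈ Z := by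
    intro g
    change ((∀ z ∈ Z, ∃ l, g * f l = z * g) ∧ ∀ l, ∃ z ∈ Z, g * f l = z * g) ↔ _
    constructor
    · rintro ⟨h1, h2⟩ x
      constructor
      · rintro ⟨l, rfl⟩
        obtain ⟨z, hz, h⟩ := h2 l
        rwa [h, mul_inv_cancel_right]
      · intro hx
        obtain ⟨l, h⟩ := h1 _ hx
        refine ⟨l, ?_⟩
        rwa [inv_mul_cancel_right, mul_right_inj] at h
    · intro h
      constructor
      · intro z hz
        have h1 : g⁻¹ * z * g ∈ f.range := by
          rw [h]
          simpa [mul_assoc] using hz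
        obtain ⟨l, hl⟩ := h1
        exact ⟨l, by rw [hl]; simp [mul_assoc]⟩
      · intro l
        exact ⟨_, (h (f l)).1 ⟨l, rfl⟩, by simp⟩
  have hr : ∀ g : G, (Biset.ident G).rstab f g = ⊥ := by
    intro g
    rw [eq_bot_iff]
    intro l h
    have h1 : g * f l = g := h
    rw [mul_eq_left] at h1
    exact hf (h1.trans f.map_one.symm)
  rw [hid]
  constructor
  · intro h
    obtain ⟨g, h1, -⟩ := exists_linked_of_mark_ne_zero hf h
    exact ⟨g, (hl g).1 h1⟩
  · rintro ⟨g, h⟩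
    refine mark_ne_zero_of_linked hf ?_ (fun g _ => hr g) ((hl g).2 h)
    rw [tConst_bot]
    exact_mod_cast Nat.card_ne_zero.2 ⟨⟨(1 : L)⟩, inferInstance⟩

/-- The internal product of the Burnside algebra. -/
def prodMul (a b : FB F G) : FB F G :=
  res ((MonoidHom.id G).prod (MonoidHom.id G)) (ext a b)

omit [Finite G] [CharZero F] in
theorem mark_prodMul (X : Subgroup G) (a b : FB F G) :
    mark X (prodMul a b) = mark X a * mark X b := by
  rw [prodMul, mark_res, mark_ext, Subgroup.map_map, Subgroup.map_map]
  exact congrArg₂ (fun Z Z' => mark Z a * mark Z' b) (Subgroup.map_id X) (Subgroup.map_id X)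

/-- Marks are multiplicative, those of `gluck F f` live on the conjugates of the range of `f`, and
the mark of `a` is constant on these. -/
theorem gluck_prodMul {f : L →* G} (hf : Function.Injective f) (a : FB F G) :
    prodMul (gluck F f) a = mark f.range a • gluck F f := by
  refine mark_injective fun X => ?_
  rw [mark_prodMul, map_smul, smul_eq_mul]
  by_cases h : mark X (gluck F f) = 0
  · rw [h, zero_mul, mul_zero]
  · obtain ⟨g, hg⟩ := (mark_gluck_ne_zero_iff hf).1 h
    rw [mark_conj g hg, mul_comm]

end FB

/-! ### Bisets attached to homomorphisms -/

namespace Biset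

variable {G H K : Type u} [Group G] [Group H] [Group K] [Finite H]

/-- The `(G, H)`-biset `H` on which `G` acts through a homomorphism `G → H`. -/
def ofRes (f : G →* H) : Biset G H :=
  letI : MulAction G H := MulAction.compHom H f
  { carrier := H
    comm := ⟨fun g h x => (mul_assoc (f g) x h.unop).symm⟩ }

/-- The `(H, G)`-biset `H` on which `G` acts through a homomorphism `G → H`. -/
def ofInd (f : G →* H) : Biset H G :=
  letI : MulAction Gᵐᵒᵖ H := MulAction.compHom H f.op
  { carrier := H
    comm := ⟨fun h g x => (mul_assoc h x (f g.unop)).symm⟩ }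

theorem ofRes_shift [Finite K] (f : G →* H) :
    ((ofRes f).shift K).IsIso (ofRes (f.prodMap (MonoidHom.id K))) :=
  ⟨Equiv.refl _, fun _ _ => rfl, fun _ _ => rfl⟩

theorem ofInd_shift [Finite K] (f : G →* H) :
    ((ofInd f).shift K).IsIso (ofInd (f.prodMap (MonoidHom.id K))) :=
  ⟨Equiv.refl _, fun _ _ => rfl, fun _ _ => rfl⟩

end Biset

namespace FB

variable {F : Type v} [Field F] {G H K : Type u} [Group G] [Group H] [Group K] [Finite H]
  [Finite K]

theorem map_ofRes (f : G →* H) (a : FB F H) : map (Biset.ofRes f) a = res f a := by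
  refine LinearMap.congr_fun (f := map (Biset.ofRes f)) (g := res f) (hom_ext fun X => ?_) a
  rw [map_of, res_of]
  symm
  apply of_eq_of_isIso
  refine GSet.IsIso.of_bijective (X := X.res f) (Y := (Biset.ofRes f).app X)
    (fun x => (Biset.ofRes f).tmk (X := X.carrier) (1 : H) x) ⟨?_, ?_⟩ ?_
  · intro x y hxy
    obtain ⟨h, h1, h2⟩ := (Biset.ofRes f).tmk_inj (X := X.carrier) (1 : H) x (1 : H) y hxy
    have h3 : (1 : H) * h = 1 := h1
    rw [one_mul] at h3
    rw [h2, h3]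
    exact one_smul H (show X.carrier from y)
  · intro t
    obtain ⟨u, x, rfl⟩ := (Biset.ofRes f).exists_tmk t
    refine ⟨(show H from u) • (show X.carrier from x), ?_⟩
    exact (Biset.ofRes f).tmk_eq (X := X.carrier) (show H from u) (one_mul (show H from u)) rfl
  · intro g x
    change (Biset.ofRes f).tmk (X := X.carrier) (1 : H) (f g • (show X.carrier from x)) =
      (Biset.ofRes f).tmk (X := X.carrier) (f g * 1 : H) x
    symm
    refine (Biset.ofRes f).tmk_eq (X := X.carrier) (f g)⁻¹ ?_ ?_
    · change f g * 1 * (f g)⁻¹ = 1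
      simp
    · exact (inv_smul_smul (f g) (show X.carrier from x)).symm

theorem mapK_ofRes (f : G →* H) (a : FB F (H × K)) :
    mapK K (Biset.ofRes f) a = res (f.prodMap (MonoidHom.id K)) a := by
  unfold mapK
  rw [map_eq_of_isIso (Biset.ofRes_shift f), map_ofRes]

theorem mapK_ofInd (f : G →* H) (a : FB F (G × K)) :
    mapK K (Biset.ofInd f) a = map (Biset.ofInd (f.prodMap (MonoidHom.id K))) a := by
  unfold mapK
  rw [map_eq_of_isIso (Biset.ofInd_shift f)]

omit [Finite H] [Finite K] in
theorem mark_mulK (X : Subgroup ((G × H) × K)) (a : FB F (G × K)) (b : FB F (H × K)) :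
    mark X (mulK a b) =
      mark (X.map ((MonoidHom.fst G H).prodMap (MonoidHom.id K))) a *
      mark (X.map ((MonoidHom.snd G H).prodMap (MonoidHom.id K))) b := by
  unfold mulK
  rw [LinearMap.compr₂_apply, mark_res, mark_ext, Subgroup.map_map, Subgroup.map_map]
  rfl

/-- The internal product is obtained from the products of `FB_K` by restriction to the
diagonal. -/
theorem prodMul_eq_mapK (a b : FB F (H × K)) :
    prodMul a b =
      mapK K (Biset.ofRes ((MonoidHom.id H).prod (MonoidHom.id H))) (mulK a b) := by
  unfold mulK
  rw [mapK_ofRes, LinearMap.compr₂_apply]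
  refine LinearMap.congr_fun₂ (f := ext.compr₂ (res _))
    (g := (ext.compr₂ (res (diag H H K))).compr₂ (res _)) ?_ a b
  refine hom_ext fun X => hom_ext fun Y => ?_
  simp only [LinearMap.compr₂_apply, ext_of, res_of]
  rfl

end FB

/-! ## Ideals of `FB_K` and closed sets of groups over `K` -/

namespace GrpOver

variable {K : Type u} [Group K]

/-- A subgroup of `G × K`, as a group over `K` by the second projection. -/
abbrev ofSub {G : Type u} [Group G] [Finite G] [Finite K] (X : Subgroup (G × K)) : GrpOver K :=
  ⟨X, (MonoidHom.snd G K).comp X.subtype⟩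

/-- The quotient of a group over `K` by a normal subgroup contained in the kernel. -/
abbrev quotient (A : GrpOver K) (N : Subgroup A.L) [N.Normal] (h : N ≤ A.φ.ker) : GrpOver K :=
  ⟨A.L ⧸ N, QuotientGroup.lift N A.φ h⟩

/-- The projection on a quotient. -/
def toQuotient (A : GrpOver K) (N : Subgroup A.L) [N.Normal] (h : N ≤ A.φ.ker) :
    A ⟶ A.quotient N h :=
  ⟨QuotientGroup.mk' N, 1, fun l => by
    rw [one_mul, inv_one, mul_one]
    rfl⟩

/-- The embedding of `L` in `L × K` with image the graph of `φ`. -/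
def emb (A : GrpOver K) : A.L →* A.L × K := (MonoidHom.id A.L).prod A.φ

theorem emb_injective (A : GrpOver K) : Function.Injective A.emb :=
  fun _ _ h => congrArg Prod.fst h

theorem ker_hom_le {A B : GrpOver K} (f : A ⟶ B) : f.1.ker ≤ A.φ.ker := by
  intro l hl
  obtain ⟨k, hk⟩ := f.2
  have := hk l
  rw [MonoidHom.mem_ker] at hl
  rw [hl, map_one, conj_eq_one_iff] at this
  exact this

theorem IsQuotient.refl (A : GrpOver K) : A.IsQuotient A :=
  ⟨CategoryTheory.CategoryStruct.id A, fun l => ⟨l, rfl⟩⟩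

theorem IsQuotient.trans {A B C : GrpOver K} (h : A.IsQuotient B) (h' : B.IsQuotient C) :
    A.IsQuotient C := by
  obtain ⟨f, hf⟩ := h
  obtain ⟨g, hg⟩ := h'
  exact ⟨CategoryTheory.CategoryStruct.comp f g, hg.comp hf⟩

/-- A set of groups over `K` closed under the two operations under which the set attached
to an ideal is closed. -/
structure Closed (P : GrpOver K → Prop) : Prop where
  of_isQuotient : ∀ {A B : GrpOver K}, A.IsQuotient B → P B → P A
  of_hom : ∀ {A B : GrpOver K} (f : A ⟶ B), Function.Surjective f.1 → tConst f.1.ker ≠ 0 →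
    P A → P B

end GrpOver

/-- The map sends `z` to the class of any `l` with `u l = z u`. It is multiplicative because the
left and right actions commute. -/
theorem Biset.exists_hom_of_linked {G H L : Type u} [Group G] [Group H] [Group L]
    {U : Biset H G} {Z : Subgroup H} {f : L →* G} {u : U.carrier} (h : U.Linked Z f u)
    [(U.rstab f u).Normal] : ∃ p : Z →* L ⧸ U.rstab f u, Function.Surjective p ∧
      ∀ (z : Z) (l : L), p z = (l : L ⧸ U.rstab f u) ↔ op (f l) • u = (z : H) • u := by
  have heq : ∀ a b : L, (a : L ⧸ U.rstab f u) = b ↔ op (f a) • u = op (f b) • u := by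
    intro a b
    rw [← div_eq_one, ← QuotientGroup.mk_div, QuotientGroup.eq_one_iff, mem_rstab, map_div,
      div_eq_mul_inv, op_mul, mul_smul, op_inv, inv_smul_eq_iff]
  choose c hc using fun z : Z => h.1 z.1 z.2
  have hp : ∀ (z : Z) (l : L), (c z : L ⧸ U.rstab f u) = l ↔ op (f l) • u = (z : H) • u := by
    intro z l
    rw [heq, hc, eq_comm]
  refine ⟨MonoidHom.mk' (fun z => (c z : L ⧸ U.rstab f u)) fun z z' => ?_, ?_, hp⟩
  · rw [← QuotientGroup.mk_mul, hp, map_mul, op_mul, mul_smul, hc, ← smul_comm, hc,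
      Subgroup.coe_mul, mul_smul]
  · intro t
    obtain ⟨l, rfl⟩ := QuotientGroup.mk_surjective t
    obtain ⟨z, hz, hl⟩ := h.2 l
    exact ⟨⟨z, hz⟩, (hp _ _).2 hl⟩

/-! ### From closed classes of groups over `K` to ideals. -/

section

variable {F : Type v} [Field F] [CharZero F] {K : Type u} [Group K] [Finite K]

open GrpOver

theorem isQuotient_map {G H : Type u} [Group G] [Finite G] [Group H] [Finite H]
    (X : Subgroup (G × K)) (p : G →* H) :
    (ofSub X).IsQuotient (ofSub (X.map (p.prodMap (MonoidHom.id K)))) := by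
  refine ⟨⟨(p.prodMap (MonoidHom.id K)).subgroupMap X, 1, fun l => ?_⟩,
    MonoidHom.subgroupMap_surjective _ X⟩
  rw [one_mul, inv_one, mul_one]
  rfl

/-- Both closure properties in succession: down from `Y` to `Y / N`, then up to `X` along `p`. The
element `k` supplies the inner automorphism in the morphism from `X`. -/
theorem GrpOver.Closed.of_quotient {P : GrpOver K → Prop} (hP : Closed P) {G H : Type u} [Group G]
    [Finite G] [Group H] [Finite H] {Y : Subgroup (G × K)} {X : Subgroup (H × K)}
    {N : Subgroup Y} [N.Normal] (hN : ∀ y ∈ N, (y : G × K).2 = 1) (ht : tConst N ≠ 0)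
    {p : X →* Y ⧸ N} (hp : Function.Surjective p) (k : K)
    (hpk : ∀ (x : X) (y : Y), p x = y → k * (y : G × K).2 = (x : H × K).2 * k)
    (hY : P (ofSub Y)) : P (ofSub X) := by
  have hB : P ((ofSub Y).quotient N hN) := by
    refine hP.of_hom ((ofSub Y).toQuotient N hN) (QuotientGroup.mk'_surjective N) ?_ hY
    have h1 : ((ofSub Y).toQuotient N hN).1.ker = N := QuotientGroup.ker_mk' N
    rwa [h1]
  refine hP.of_isQuotient ⟨⟨p, k⁻¹, fun x => ?_⟩, hp⟩ hB
  obtain ⟨y, hy⟩ := QuotientGroup.mk_surjective (p x)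
  have h2 := hpk x y hy.symm
  have h3 : k⁻¹ * (x : H × K).2 * k⁻¹⁻¹ = (y : G × K).2 := by
    rw [inv_inv, mul_assoc, ← h2, inv_mul_cancel_left]
  refine h3.trans ?_
  rw [← hy]
  rfl

/-- A linked point `(u, k)` of `U × K` provides all the data: its `K`-component forces the
stabilizer into the kernel of the projection to `K`, and shows that the two structure maps agree up
to conjugation by `k`. -/
theorem GrpOver.Closed.of_mark_mapK {P : GrpOver K → Prop} (hP : Closed P) {G H : Type u} [Group G]
    [Finite G] [Group H] [Finite H] {U : Biset H G} {Y : Subgroup (G × K)}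
    {X : Subgroup (H × K)} (h : FB.mark X (FB.mapK K U (FB.gluck F Y.subtype)) ≠ 0)
    (hY : P (ofSub Y)) : P (ofSub X) := by
  obtain ⟨⟨u, k⟩, hl, ht⟩ := FB.exists_linked_of_mark_ne_zero Y.subtype_injective h
  have hN := Biset.rstab_normal hl
  obtain ⟨p, hp, hpl⟩ := Biset.exists_hom_of_linked hl
  refine hP.of_quotient (fun y hy => ?_) ht hp (show K from k) (fun x y hxy => ?_) hY
  · have h1 : (show K from k) * (y : G × K).2 = k := congrArg Prod.snd hy
    rwa [mul_eq_left] at h1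
  · exact congrArg Prod.snd ((hpl x y).1 hxy)

/-- The elements of `F B(G × K)` whose marks vanish outside of a set of groups over `K`. -/
def supportedOn (F : Type v) [Field F] (P : GrpOver K → Prop) (G : Type u) [Group G] [Finite G] :
    Submodule F (FB F (G × K)) where
  carrier := {a | ∀ X : Subgroup (G × K), FB.mark X a ≠ 0 → P (ofSub X)}
  zero_mem' := fun X h => absurd (map_zero (FB.mark X)) h
  add_mem' := fun {a b} ha hb X h => by
    by_cases h1 : FB.mark X a = 0
    · refine hb X fun h2 => h ?_
      rw [map_add, h1, h2, add_zero]
    · exact ha X h1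
  smul_mem' := fun c {a} ha X h => ha X fun h1 => h (by rw [map_smul, h1, smul_zero])

theorem mapK_mem_supportedOn {P : GrpOver K → Prop} (hP : Closed P) {G H : Type u} [Group G]
    [Finite G] [Group H] [Finite H] (U : Biset H G) {a : FB F (G × K)}
    (ha : a ∈ supportedOn F P G) : FB.mapK K U a ∈ supportedOn F P H := by
  intro X h
  rw [FB.eq_sum a, map_smul, map_smul, _root_.map_sum, _root_.map_sum] at h
  obtain ⟨Y, -, hY⟩ := Finset.exists_ne_zero_of_sum_ne_zero (right_ne_zero_of_smul h)
  rw [map_smul, map_smul] at hY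
  exact hP.of_mark_mapK (right_ne_zero_of_smul hY) (ha Y (left_ne_zero_of_smul hY))

omit [CharZero F] in
-- A non-zero mark at `X` requires a non-zero mark of `b` at the projection of `X` to `H × K`, and
-- `X` surjects onto this projection over `K`.
theorem mulK_mem_supportedOn {P : GrpOver K → Prop} (hP : Closed P) {G H : Type u} [Group G]
    [Finite G] [Group H] [Finite H] (a : FB F (G × K)) {b : FB F (H × K)}
    (hb : b ∈ supportedOn F P H) : FB.mulK a b ∈ supportedOn F P (G × H) := by
  intro X h
  rw [FB.mark_mulK] at h
  exact hP.of_isQuotient (isQuotient_map X (MonoidHom.snd G H)) (hb _ (right_ne_zero_of_mul h))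

/-- The ideal of `FB_K` attached to a closed set of groups over `K`. -/
def GrpOver.Closed.ideal (F : Type v) [Field F] [CharZero F] {P : GrpOver K → Prop} (hP : Closed P) :
    (shiftedBurnside F K).Sub where
  carrier G _ _ := supportedOn F P G
  map_mem U _ ha := mapK_mem_supportedOn hP U ha
  mul_mem a _ hb := mulK_mem_supportedOn hP a hb

/-! ### From ideals to closed classes of groups over `K`. -/

namespace FBKModule.Sub

variable (I : (shiftedBurnside F K).Sub)

/-- The groups over `K` whose idempotent lies in a given ideal. -/
def Mem (A : GrpOver K) : Prop := FB.gluck F A.emb ∈ I.carrier A.L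

variable {I} {G : Type u} [Group G] [Finite G]

omit [CharZero F] in
-- Each evaluation of an ideal is an ideal of the Burnside ring for its internal product, since this
-- product is an external one followed by a biset operation.
theorem prodMul_mem (a : FB F (G × K)) {b : FB F (G × K)} (hb : b ∈ I.carrier G) :
    FB.prodMul a b ∈ I.carrier G := by
  rw [FB.prodMul_eq_mapK]
  exact I.map_mem _ (I.mul_mem a hb)

/-- Multiplying `a` by the idempotent leaves the mark of `a` times the idempotent, and the mark can
be divided out. -/
theorem gluck_mem_of_mark {L : Type u} [Group L] [Finite L] {f : L →* G × K}
    (hf : Function.Injective f) {a : FB F (G × K)} (ha : a ∈ I.carrier G)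
    (h : FB.mark f.range a ≠ 0) : FB.gluck F f ∈ I.carrier G := by
  have h1 := I.prodMul_mem (FB.gluck F f) ha
  rw [FB.gluck_prodMul hf] at h1
  have h2 := (I.carrier G).smul_mem (FB.mark f.range a)⁻¹ h1
  have h3 : (FB.mark f.range a)⁻¹ • FB.mark f.range a • FB.gluck F f = FB.gluck F f :=
    inv_smul_smul₀ h _
  rwa [← h3]

theorem gluck_mem_of_conj {L L' : Type u} [Group L] [Finite L] [Group L'] [Finite L']
    {f : L →* G × K} (hf : Function.Injective f) {f' : L' →* G × K}
    (hf' : Function.Injective f') (g : G × K)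
    (h : ∀ x, x ∈ f'.range ↔ g * x * g⁻¹ ∈ f.range)
    (hm : FB.gluck F f' ∈ I.carrier G) : FB.gluck F f ∈ I.carrier G :=
  gluck_mem_of_mark hf hm ((FB.mark_gluck_ne_zero_iff hf').2 ⟨g, h⟩)

theorem mem_carrier_iff {a : FB F (G × K)} : a ∈ I.carrier G ↔
    ∀ X : Subgroup (G × K), FB.mark X a ≠ 0 → FB.gluck F X.subtype ∈ I.carrier G := by
  constructor
  · intro ha X h
    refine gluck_mem_of_mark X.subtype_injective ha ?_
    rwa [Subgroup.range_subtype]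
  · intro h
    rw [FB.eq_sum a]
    refine (I.carrier G).smul_mem _ ((I.carrier G).sum_mem fun X _ => ?_)
    by_cases hX : FB.mark X a = 0
    · have h0 : FB.mark X a • FB.gluck F X.subtype = 0 := by rw [hX, zero_smul]
      exact h0 ▸ (I.carrier G).zero_mem
    · exact (I.carrier G).smul_mem _ (h X hX)

/-- Induction along `p`. In the biset `G × K` with `L` acting on the right through `(p, φ)`, every
point has stabilizer `ker p ∩ ker φ`, so the mark at the image of `L` does not vanish. -/
theorem gluck_mem_of_hom {A : GrpOver K} (hA : I.Mem A) (p : A.L →* G)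
    (hp : tConst (p.ker ⊓ A.φ.ker) ≠ 0) :
    FB.gluck F (p.prod A.φ).range.subtype ∈ I.carrier G := by
  have h1 := I.map_mem (Biset.ofInd p) hA
  refine gluck_mem_of_mark (Subgroup.subtype_injective _) h1 ?_
  rw [Subgroup.range_subtype]
  change FB.mark _ (FB.mapK K (Biset.ofInd p) (FB.gluck F A.emb)) ≠ 0
  rw [FB.mapK_ofInd]
  refine FB.mark_ne_zero_of_linked A.emb_injective hp ?_ (u := (1 : G × K)) ?_
  · intro u _
    ext l
    change (show G × K from u) * (p l, A.φ l) = (show G × K from u) ↔ _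
    rw [mul_eq_left, Prod.mk_eq_one, Subgroup.mem_inf, MonoidHom.mem_ker, MonoidHom.mem_ker]
  · have h2 : ∀ l, (1 : G × K) * (p l, A.φ l) = (p.prod A.φ) l * 1 := by simp
    constructor
    · rintro _ ⟨l, rfl⟩
      exact ⟨l, h2 l⟩
    · intro l
      exact ⟨_, ⟨l, rfl⟩, h2 l⟩

/-- Induction and restriction along the first projection `X → G` exchange `X ≤ G × K` with the graph
of its second projection in `X × K`. The relevant kernel is trivial, since the two projections
together separate the points of `X`. -/
theorem mem_ofSub_iff {X : Subgroup (G × K)} :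
    I.Mem (ofSub X) ↔ FB.gluck F X.subtype ∈ I.carrier G := by
  let p : X →* G := (MonoidHom.fst G K).comp X.subtype
  constructor
  · intro h
    have h1 := gluck_mem_of_hom h p ?_
    · have h2 : (p.prod (ofSub X).φ).range = X := X.range_subtype
      exact h2 ▸ h1
    · have h3 : p.ker ⊓ (ofSub X).φ.ker = ⊥ := by
        rw [eq_bot_iff]
        rintro x ⟨h1, h2⟩
        exact Subtype.ext (Prod.ext h1 h2)
      refine (congrArg tConst h3).trans_ne (tConst_bot.trans_ne ?_)
      exact_mod_cast Nat.card_ne_zero.2 ⟨⟨1⟩, inferInstance⟩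
  · intro h
    have h1 := I.map_mem (Biset.ofRes p) h
    refine gluck_mem_of_mark (ofSub X).emb_injective h1 ?_
    change FB.mark _ (FB.mapK K (Biset.ofRes p) (FB.gluck F X.subtype)) ≠ 0
    rw [FB.mapK_ofRes, FB.mark_res, FB.mark_gluck_ne_zero_iff X.subtype_injective]
    refine ⟨1, fun x => ?_⟩
    have h2 : (ofSub X).emb.range.map (p.prodMap (MonoidHom.id K)) = X.subtype.range := by
      rw [MonoidHom.range_eq_map, Subgroup.map_map, ← MonoidHom.range_eq_map]
      rfl
    rw [h2]
    simp

/-- An ideal is determined by the groups over `K` whose idempotent it contains. -/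
theorem mem_carrier_iff_ofSub {a : FB F (G × K)} : a ∈ I.carrier G ↔
    ∀ X : Subgroup (G × K), FB.mark X a ≠ 0 → I.Mem (ofSub X) := by
  rw [mem_carrier_iff]
  exact forall₂_congr fun X _ => mem_ofSub_iff.symm

/-- The set of groups over `K` whose idempotent lies in an ideal is closed. -/
theorem closed_mem (I : (shiftedBurnside F K).Sub) : Closed I.Mem where
  of_isQuotient := by
    rintro A B ⟨⟨f, k, hk⟩, hf⟩ h
    have h1 := I.map_mem (Biset.ofRes f) h
    refine gluck_mem_of_mark A.emb_injective h1 ?_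
    change FB.mark _ (FB.mapK K (Biset.ofRes f) (FB.gluck F B.emb)) ≠ 0
    rw [FB.mapK_ofRes, FB.mark_res, FB.mark_gluck_ne_zero_iff B.emb_injective]
    -- The image of the graph of `A` under `f × id` is the graph of `B` conjugated in the
    -- `K`-coordinate, by the inverse of the element defining the inner automorphism of `f`.
    refine ⟨(1, k⁻¹), fun x => ?_⟩
    constructor
    · rintro ⟨b, rfl⟩
      obtain ⟨a, rfl⟩ := hf b
      refine ⟨_, ⟨a, rfl⟩, Prod.ext ?_ ?_⟩
      · change f a = 1 * f a * 1⁻¹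
        simp
      · change A.φ a = k⁻¹ * B.φ (f a) * k⁻¹⁻¹
        rw [← hk]
        group
    · rintro ⟨_, ⟨a, rfl⟩, h⟩
      refine ⟨f a, Prod.ext ?_ ?_⟩
      · have h1 : f a = 1 * x.1 * 1⁻¹ := congrArg Prod.fst h
        rwa [_root_.one_mul, inv_one, mul_one] at h1
      · have h1 : A.φ a = k⁻¹ * x.2 * k⁻¹⁻¹ := congrArg Prod.snd h
        change B.φ (f a) = x.2
        rw [← hk, h1]
        group
  of_hom := by
    intro A B f hf ht h
    -- The kernel of a morphism over `K` lies in `ker φ`, so the intersection is `ker f`. The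
    -- resulting subgroup is the graph of `B` only up to conjugation by `(1, k)`.
    have h1 := gluck_mem_of_hom h f.1 (by rwa [inf_eq_left.2 (ker_hom_le f)])
    obtain ⟨f, k, hk⟩ := f
    refine gluck_mem_of_conj B.emb_injective (Subgroup.subtype_injective _) (1, k) (fun x => ?_) h1
    rw [Subgroup.range_subtype]
    constructor
    · rintro ⟨a, rfl⟩
      refine ⟨f a, Prod.ext ?_ (hk a).symm⟩
      change f a = 1 * f a * 1⁻¹
      simp
    · rintro ⟨b, h⟩
      obtain ⟨a, rfl⟩ := hf b
      refine ⟨a, Prod.ext ?_ ?_⟩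
      · have h1 : f a = 1 * x.1 * 1⁻¹ := congrArg Prod.fst h
        rwa [_root_.one_mul, inv_one, mul_one] at h1
      · have h1 : B.φ (f a) = k * x.2 * k⁻¹ := congrArg Prod.snd h
        change A.φ a = x.2
        rw [← hk] at h1
        simpa using h1

theorem le_iff {I J : (shiftedBurnside F K).Sub} : I ≤ J ↔ ∀ A, I.Mem A → J.Mem A := by
  constructor
  · intro h A hA
    exact h A.L hA
  · intro h G _ _ a ha
    exact mem_carrier_iff_ofSub.2 fun X hX => h _ (mem_carrier_iff_ofSub.1 ha X hX)

end FBKModule.Sub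

end

/-! ## `B_K`-groups -/

namespace GrpOver

variable {K : Type u} [Group K]

theorem nonempty_iso_of_bijective {A B : GrpOver K} (f : A ⟶ B) (hf : Function.Bijective f.1) :
    Nonempty (A ≅ B) := by
  obtain ⟨f, k, hk⟩ := f
  let e : A.L ≃* B.L := MulEquiv.ofBijective f hf
  refine ⟨⟨⟨f, k, hk⟩, ⟨e.symm.toMonoidHom, k⁻¹, fun b => ?_⟩, ?_, ?_⟩⟩
  · obtain ⟨a, rfl⟩ := hf.2 b
    rw [← hk]
    change _ = A.φ (e.symm (e a))
    rw [e.symm_apply_apply]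
    group
  · exact Subtype.ext (MonoidHom.ext fun a => e.symm_apply_apply a)
  · exact Subtype.ext (MonoidHom.ext fun b => e.apply_symm_apply b)

theorem IsQuotient.antisymm {A B : GrpOver K} (h : A.IsQuotient B) (h' : B.IsQuotient A) :
    Nonempty (A ≅ B) := by
  obtain ⟨f, hf⟩ := h
  obtain ⟨g, hg⟩ := h'
  have h1 : Nat.card B.L = Nat.card A.L :=
    le_antisymm (Nat.card_le_card_of_surjective _ hf) (Nat.card_le_card_of_surjective _ hg)
  refine nonempty_iso_of_bijective f ?_
  exact (Nat.bijective_iff_surjective_and_card _).2 ⟨hf, h1.symm⟩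

theorem isQuotient_of_iso {A B : GrpOver K} (e : A ≅ B) : A.IsQuotient B := by
  refine ⟨e.hom, fun b => ⟨e.inv.1 b, ?_⟩⟩
  exact DFunLike.congr_fun (congrArg Subtype.val e.inv_hom_id) b

theorem isQuotient_of_ker_le {A B C : GrpOver K} {f : A ⟶ B} {g : A ⟶ C}
    (hf : Function.Surjective f.1) (hg : Function.Surjective g.1) (h : g.1.ker ≤ f.1.ker) :
    C.IsQuotient B := by
  obtain ⟨f, k, hk⟩ := f
  obtain ⟨g, l, hl⟩ := g
  let p : C.L →* B.L := g.liftOfSurjective hg ⟨f, h⟩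
  have hp : ∀ a, p (g a) = f a := fun a => MonoidHom.liftOfRightInverse_comp_apply g _ _ ⟨f, h⟩ a
  refine ⟨⟨p, k * l⁻¹, fun c => ?_⟩, fun b => ?_⟩
  · obtain ⟨a, rfl⟩ := hg c
    rw [hp, ← hk, ← hl]
    group
  · obtain ⟨a, rfl⟩ := hf b
    exact ⟨g a, hp a⟩

theorem ker_restrict_hom {A B : GrpOver K} (f : A ⟶ B) (X : Subgroup A.L) :
    ∃ k : K, ∀ x : X, k * (A.φ.comp X.subtype) x * k⁻¹ = B.φ ((f.1.comp X.subtype) x) := by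
  obtain ⟨k, hk⟩ := f.2
  exact ⟨k, fun x => hk x⟩

/-- A quotient `B` of `M` by a subgroup `N` with `m_{M,N} ≠ 0` has the same `B_K`-group
quotients as `M`. -/
theorem IsBKGroup.isQuotient_of_hom {A : GrpOver K} (hA : A.IsBKGroup) {M B : GrpOver K}
    (f : M ⟶ A) (hf : Function.Surjective f.1) (g : M ⟶ B) (hg : Function.Surjective g.1)
    (ht : tConst g.1.ker ≠ 0) : B.IsQuotient A := by
  induction h : Nat.card M.L using Nat.strong_induction_on generalizing M with
  | h n ih =>
  subst h
  by_cases hle : g.1.ker ≤ f.1.ker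
  · exact isQuotient_of_ker_le hf hg hle
  have h1 : tConst (g.1.ker.map f.1) = 0 := by
    rw [← mConst_eq_zero_iff]
    refine hA _ (Subgroup.Normal.map inferInstance _ hf) ?_ ?_
    · rwa [Ne, Subgroup.map_eq_bot_iff]
    · rintro _ ⟨n, hn, rfl⟩
      obtain ⟨k, hk⟩ := f.2
      have h2 : M.φ n = 1 := ker_hom_le g hn
      rw [MonoidHom.mem_ker, ← hk, h2]
      simp
  have h2 := sum_tConst_restrict hf hg
  rw [h1, mul_zero] at h2
  -- The sum over the supplements of `ker f` is zero while its term at `⊤` is `tConst` of `ker g`,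
  -- hence non-zero; some proper supplement must also contribute.
  have h3 : ∃ X : Subgroup M.L, X ≠ ⊤ ∧ X.map f.1 = ⊤ ∧
      (∑ Y : Subgroup X, if (Y.map X.subtype).map g.1 = ⊤ then
        (Nat.card Y : ℤ) * moebius Y ⊤ else 0) ≠ 0 := by
    by_contra! hX
    rw [Finset.sum_eq_single ⊤] at h2
    · rw [if_pos (by rw [← MonoidHom.range_eq_map, MonoidHom.range_eq_top.2 hf])] at h2
      apply ht
      rw [tConst_ker hg]
      refine Eq.trans ?_ h2
      have h4 := sum_subgroups_le (⊤ : Subgroup M.L)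
        (fun Y => if Y.map g.1 = ⊤ then (Nat.card Y : ℤ) * moebius Y ⊤ else 0)
      simp only [le_top, if_true] at h4
      rw [h4]
      refine Finset.sum_congr rfl fun Y _ => ?_
      rw [moebius_map_subtype, Subgroup.card_map_of_injective (Subgroup.subtype_injective _)]
    · intro X _ hXt
      split_ifs with hXf
      · exact hX X hXt hXf
      · rfl
    · simp
  obtain ⟨X, hXt, hXf, hX⟩ := h3
  -- A non-zero sum is in particular non-empty, which makes the restriction of `g` to `X`
  -- surjective; the induction hypothesis then applies to `X`.
  obtain ⟨Y, -, hY⟩ := Finset.exists_ne_zero_of_sum_ne_zero hX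
  have hYg : (Y.map X.subtype).map g.1 = ⊤ := by
    by_contra hne
    exact hY (if_neg hne)
  have hf' : Function.Surjective (f.1.comp X.subtype) := by
    rw [← MonoidHom.range_eq_top, MonoidHom.range_comp, Subgroup.range_subtype, hXf]
  have hg' : Function.Surjective (g.1.comp X.subtype) := by
    rw [← MonoidHom.range_eq_top, MonoidHom.range_comp, Subgroup.range_subtype, ← top_le_iff,
      ← hYg]
    exact Subgroup.map_mono (Subgroup.map_subtype_le Y)
  have hlt : Nat.card X < Nat.card M.L := by
    refine lt_of_le_of_ne (Subgroup.card_le_card_group X) fun he => hXt ?_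
    exact Subgroup.eq_top_of_card_eq X he
  refine ih _ hlt (M := ⟨X, M.φ.comp X.subtype⟩)
    ⟨f.1.comp X.subtype, ker_restrict_hom f X⟩ hf'
    ⟨g.1.comp X.subtype, ker_restrict_hom g X⟩ hg' ?_ rfl
  rw [tConst_ker hg']
  simpa only [Subgroup.map_map] using hX

theorem IsBKGroup.closed {A : GrpOver K} (hA : A.IsBKGroup) :
    Closed fun M : GrpOver K => M.IsQuotient A where
  of_isQuotient := IsQuotient.trans
  of_hom := by
    rintro M B g hg ht ⟨f, hf⟩
    exact hA.isQuotient_of_hom f hf g hg ht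

/-- Every group over `K` has a `B_K`-group quotient that belongs to the same closed sets. -/
theorem exists_isBKGroup (A : GrpOver K) : ∃ B : GrpOver K, B.IsBKGroup ∧ A.IsQuotient B ∧
    ∀ P : GrpOver K → Prop, Closed P → P A → P B := by
  induction h : Nat.card A.L using Nat.strong_induction_on generalizing A with
  | h n ih =>
  subst h
  by_cases hA : A.IsBKGroup
  · exact ⟨A, hA, IsQuotient.refl A, fun _ _ h => h⟩
  unfold IsBKGroup at hA
  push Not at hA
  -- Passing to the quotient by such an `N` lowers the order and stays in every closed class,
  -- because `tConst N` is non-zero.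
  obtain ⟨N, hN, hNb, hNk, hm⟩ := hA
  have hlt : Nat.card (A.L ⧸ N) < Nat.card A.L := by
    rw [← Subgroup.card_mul_index N]
    have h1 : 1 < Nat.card N := (Subgroup.one_lt_card_iff_ne_bot N).2 hNb
    have h2 : 0 < N.index := Nat.pos_of_ne_zero Subgroup.index_ne_zero_of_finite
    change N.index < _
    nlinarith
  obtain ⟨B, hB, hq, hP⟩ := ih _ hlt (A.quotient N hNk) rfl
  have hs : Function.Surjective (A.toQuotient N hNk).1 := QuotientGroup.mk'_surjective N
  refine ⟨B, hB, IsQuotient.trans ⟨A.toQuotient N hNk, hs⟩ hq, fun P hc hA => hP P hc ?_⟩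
  refine hc.of_hom (A.toQuotient N hNk) hs ?_ hA
  have h1 : (A.toQuotient N hNk).1.ker = N := QuotientGroup.ker_mk' N
  rw [h1]
  exact fun h => hm ((mConst_eq_zero_iff N).2 h)

end GrpOver

/-! ## The ideals attached to `B_K`-groups -/

section

open GrpOver
open FBKModule (Sub)

variable {F : Type v} [Field F] [CharZero F] {K : Type u} [Group K] [Finite K]

theorem GrpOver.isQuotient_of_conj {A : GrpOver K} {X : Subgroup (A.L × K)} {g : A.L × K}
    (h : ∀ x, x ∈ A.emb.range ↔ g * x * g⁻¹ ∈ X) : (ofSub X).IsQuotient A := by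
  have h1 : ∀ x : X, ∃ a, A.emb a = g⁻¹ * x * g := fun x => by
    have h2 : g⁻¹ * x.1 * g ∈ A.emb.range := by
      rw [h]
      simp [mul_assoc]
    exact h2
  let p : X →* A.L :=
    (MulAut.conj g.1⁻¹).toMonoidHom.comp ((MonoidHom.fst A.L K).comp X.subtype)
  have hp : ∀ x : X, p x = g.1⁻¹ * x.1.1 * g.1 := fun x => by simp [p]
  refine ⟨⟨p, g.2⁻¹, fun x => ?_⟩, fun a => ?_⟩
  · obtain ⟨a, ha⟩ := h1 x
    have h2 : a = g.1⁻¹ * x.1.1 * g.1 := congrArg Prod.fst ha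
    have h3 : A.φ a = g.2⁻¹ * x.1.2 * g.2 := congrArg Prod.snd ha
    rw [hp, ← h2, h3, inv_inv]
    rfl
  · refine ⟨⟨g * A.emb a * g⁻¹, (h _).1 ⟨a, rfl⟩⟩, ?_⟩
    refine (hp _).trans ?_
    change g.1⁻¹ * (g.1 * a * g.1⁻¹) * g.1 = a
    group

/-- The marks of the idempotent of `A` live on the conjugates of its graph, which surject onto `A`
over `K`. Thus passing from a closed class to its ideal loses nothing. -/
theorem GrpOver.Closed.mem_iff {P : GrpOver K → Prop} (hP : Closed P) (A : GrpOver K) :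
    (Closed.ideal F hP).Mem A ↔ P A := by
  constructor
  · intro h
    have h1 : P (ofSub A.emb.range) :=
      h _ ((FB.mark_gluck_ne_zero_iff A.emb_injective).2 ⟨1, by simp⟩)
    refine hP.of_isQuotient ⟨⟨A.emb.rangeRestrict, 1, fun l => ?_⟩,
      A.emb.rangeRestrict_surjective⟩ h1
    rw [one_mul, inv_one, mul_one]
    rfl
  · intro h X hX
    obtain ⟨g, hg⟩ := (FB.mark_gluck_ne_zero_iff A.emb_injective).1 hX
    exact hP.of_isQuotient (isQuotient_of_conj hg) h

/-- The two elements differ by the order of a normalizer, which is invertible in characteristic 0.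
-/
theorem idem_graph_mem_iff (I : (shiftedBurnside F K).Sub) (A : GrpOver K) :
    idem F A.graph ∈ I.carrier A.L ↔ I.Mem A := by
  have h1 : FB.gluck F A.graph.subtype = FB.gluck F A.emb := FB.gluck_range A.emb_injective
  rw [FB.idem_eq, h1]
  exact (I.carrier A.L).smul_mem_iff (inv_ne_zero (FB.card_ne_zero F _))

omit [CharZero F] in
theorem FBKModule.Sub.mem_span_self {M : FBKModule.{u, v, w} F K} (G : Type u) [Group G] [Finite G]
    (x : M.obj G) : x ∈ (Sub.span G x).carrier G := by
  simp only [Sub.span, Submodule.mem_iInf]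
  exact fun N hN => hN

theorem ideal_le_iff (I : (shiftedBurnside F K).Sub) (A : GrpOver K) :
    A.ideal F ≤ I ↔ I.Mem A := by
  rw [← idem_graph_mem_iff]
  constructor
  · intro h
    refine h A.L ?_
    exact Sub.mem_span_self (M := shiftedBurnside F K) A.L (idem F A.graph)
  · intro h G _ _
    exact iInf₂_le I h

omit [CharZero F] in
theorem FBKModule.Sub.le_self (I : (shiftedBurnside F K).Sub) : I ≤ I :=
  fun _ _ _ _ h => h

theorem mem_ideal_self (A : GrpOver K) : (A.ideal F).Mem A :=
  (ideal_le_iff _ A).1 (Sub.le_self _)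

/-- Any ideal containing `A` contains all groups above `A`. For a `B_K`-group these already form a
closed class, so its ideal bounds `e_A` from above. -/
theorem GrpOver.IsBKGroup.mem_ideal_iff {A : GrpOver K} (hA : A.IsBKGroup) (B : GrpOver K) :
    (A.ideal F).Mem B ↔ B.IsQuotient A := by
  constructor
  · intro h
    have h1 : A.ideal F ≤ Closed.ideal F hA.closed :=
      (ideal_le_iff _ A).2 ((hA.closed.mem_iff A).2 (IsQuotient.refl A))
    exact (hA.closed.mem_iff B).1 (Sub.le_iff.1 h1 B h)
  · intro h
    exact (Sub.closed_mem _).of_isQuotient h (mem_ideal_self A)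

/-- The groups over `K` that have as a quotient a `B_K`-group strictly above `A`. -/
def GrpOver.StrictlyAbove (A B : GrpOver K) : Prop :=
  ∃ C : GrpOver K, (C.IsBKGroup ∧ C.IsQuotient A ∧ ¬ Nonempty (C ≅ A)) ∧ B.IsQuotient C

omit [Finite K] in
theorem GrpOver.closed_strictlyAbove (A : GrpOver K) : Closed A.StrictlyAbove where
  of_isQuotient := by
    rintro B B' h ⟨C, hC, hB⟩
    exact ⟨C, hC, h.trans hB⟩
  of_hom := by
    rintro B B' f hf ht ⟨C, hC, hB⟩
    exact ⟨C, hC, hC.1.closed.of_hom f hf ht hB⟩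

theorem mem_ideal₀_iff (A B : GrpOver K) : (A.ideal₀ F).Mem B ↔ A.StrictlyAbove B := by
  constructor
  · intro h
    rw [← A.closed_strictlyAbove.mem_iff (F := F)]
    refine (iSup_le fun C => ?_ : (A.ideal₀ F).carrier B.L ≤
      (Closed.ideal F A.closed_strictlyAbove).carrier B.L) h
    refine (ideal_le_iff _ C.1).2 ?_ B.L
    exact (A.closed_strictlyAbove.mem_iff C.1).2 ⟨C.1, C.2, IsQuotient.refl _⟩
  · rintro ⟨C, hC, hB⟩
    refine (Sub.closed_mem _).of_isQuotient hB ?_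
    exact Submodule.mem_iSup_of_mem (p := fun C : {B : GrpOver K // B.IsBKGroup ∧
      B.IsQuotient A ∧ ¬ Nonempty (B ≅ A)} => (C.1.ideal F).carrier _) ⟨C, hC⟩ (mem_ideal_self C)

/-- Otherwise `A` and some `C` not isomorphic to it would be quotients of each other, against
`IsQuotient.antisymm`. -/
theorem not_mem_ideal₀_self (A : GrpOver K) : ¬ (A.ideal₀ F).Mem A := by
  rw [mem_ideal₀_iff]
  rintro ⟨C, ⟨-, h, hn⟩, h'⟩
  exact hn (h.antisymm h')

theorem GrpOver.IsBKGroup.ideal₀_le {A : GrpOver K} (hA : A.IsBKGroup) :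
    A.ideal₀ F ≤ A.ideal F := by
  refine Sub.le_iff.2 fun B hB => ?_
  obtain ⟨C, hC, hBC⟩ := (mem_ideal₀_iff A B).1 hB
  exact (hA.mem_ideal_iff B).2 (hBC.trans hC.2.1)

/-- `e⁰_{L,φ}` contains the ideals strictly contained in `e_{L,φ}`. -/
theorem GrpOver.IsBKGroup.le_ideal₀ {A : GrpOver K} (hA : A.IsBKGroup)
    {J : (shiftedBurnside F K).Sub} (hJ : J ≤ A.ideal F) (hJA : ¬ J.Mem A) :
    J ≤ A.ideal₀ F := by
  refine Sub.le_iff.2 fun B hB => ?_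
  -- Each member of `J` lies above a `B_K`-group `C` in `J`. This `C` is above `A`, and strictly so,
  -- since `A` is not in `J`.
  obtain ⟨C, hC, hBC, h⟩ := B.exists_isBKGroup
  have hJC := h _ J.closed_mem hB
  refine (mem_ideal₀_iff A B).2 ⟨C, ⟨hC, ?_, ?_⟩, hBC⟩
  · exact (hA.mem_ideal_iff C).1 (Sub.le_iff.1 hJ C hJC)
  · rintro ⟨e⟩
    exact hJA (J.closed_mem.of_isQuotient (isQuotient_of_iso e.symm) hJC)

end

/-! ## Quotients of submodules -/

namespace FBKModule

variable {F : Type v} [Field F] {K : Type u} [Group K] [Finite K]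

namespace Iso

variable {M N Q : FBKModule.{u, v, w} F K}

/-- The inverse of an isomorphism. -/
def symm (e : M.Iso N) : N.Iso M where
  equiv G := (e.equiv G).symm
  map_equiv {G H _ _ _ _} U n := by
    rw [LinearEquiv.symm_apply_eq, e.map_equiv, LinearEquiv.apply_symm_apply]
  mul_equiv {G H _ _ _ _} a n := by
    rw [LinearEquiv.symm_apply_eq, e.mul_equiv, LinearEquiv.apply_symm_apply]

/-- The composition of two isomorphisms. -/
def trans (e : M.Iso N) (e' : N.Iso Q) : M.Iso Q where
  equiv G := (e.equiv G).trans (e'.equiv G)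
  map_equiv U m := by
    rw [LinearEquiv.trans_apply, e.map_equiv, e'.map_equiv, LinearEquiv.trans_apply]
  mul_equiv a m := by
    rw [LinearEquiv.trans_apply, e.mul_equiv, e'.mul_equiv, LinearEquiv.trans_apply]

end Iso

namespace Sub

variable {M : FBKModule.{u, v, w} F K}

/-- The class in `N / N'` of an element of `N`. -/
def qmk (N N' : Sub M) {G : Type u} [Group G] [Finite G] (m : M.obj G) (h : m ∈ N.carrier G) :
    N.QuotObj N' G :=
  Submodule.Quotient.mk ⟨m, h⟩

theorem exists_qmk {N N' : Sub M} {G : Type u} [Group G] [Finite G] (x : N.QuotObj N' G) :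
    ∃ m h, N.qmk N' m h = x := by
  obtain ⟨⟨m, h⟩, rfl⟩ := Submodule.Quotient.mk_surjective _ x
  exact ⟨m, h, rfl⟩

theorem qmk_eq_zero {N N' : Sub M} {G : Type u} [Group G] [Finite G] {m : M.obj G}
    {h : m ∈ N.carrier G} : N.qmk N' m h = 0 ↔ m ∈ N'.carrier G := by
  unfold qmk
  rw [Submodule.Quotient.mk_eq_zero]
  rfl

/-- The preimage in `N` of a submodule of `N / N'`. -/
def pull (N N' : Sub M) (Q : Sub (N.quot N')) : Sub M where
  carrier G _ _ := (((Q.carrier G : Submodule F (N.QuotObj N' G))).comap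
    (Submodule.mkQ _)).map (N.carrier G).subtype
  map_mem := by
    rintro G H _ _ _ _ U _ ⟨m, hm, rfl⟩
    exact ⟨⟨M.map U m.1, N.map_mem U m.2⟩, Q.map_mem U hm, rfl⟩
  mul_mem := by
    rintro G H _ _ _ _ a _ ⟨m, hm, rfl⟩
    exact ⟨⟨M.mul a m.1, N.mul_mem a m.2⟩, Q.mul_mem a hm, rfl⟩

theorem mem_pull {N N' : Sub M} {Q : Sub (N.quot N')} {G : Type u} [Group G] [Finite G]
    {m : M.obj G} : m ∈ (pull N N' Q).carrier G ↔
      ∃ h : m ∈ N.carrier G, N.qmk N' m h ∈ (Q.carrier G : Submodule F (N.QuotObj N' G)) := by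
  constructor
  · rintro ⟨m, hm, rfl⟩
    exact ⟨m.2, hm⟩
  · rintro ⟨h, hm⟩
    exact ⟨⟨m, h⟩, hm, rfl⟩

theorem pull_le {N N' : Sub M} (Q : Sub (N.quot N')) : pull N N' Q ≤ N := by
  intro G _ _ m hm
  exact (mem_pull.1 hm).1

/-- The image in `N / N'` of a submodule. -/
def push (N N' J : Sub M) : Sub (N.quot N') where
  carrier G _ _ := ((J.carrier G).comap (N.carrier G).subtype).map
    (Submodule.mkQ ((N'.carrier G).submoduleOf (N.carrier G)))
  map_mem := by
    rintro G H _ _ _ _ U _ ⟨m, hm, rfl⟩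
    exact ⟨⟨M.map U m.1, N.map_mem U m.2⟩, J.map_mem U hm, rfl⟩
  mul_mem := by
    rintro G H _ _ _ _ a _ ⟨m, hm, rfl⟩
    exact ⟨⟨M.mul a m.1, N.mul_mem a m.2⟩, J.mul_mem a hm, rfl⟩

/-- If `N / N'` is simple, a submodule of `N` not contained in `N'` generates `N` modulo `N'`. -/
theorem exists_sub_mem_of_isSimple {N N' J : Sub M} (hs : (N.quot N').IsSimple) (hJ : J ≤ N)
    (hJN : ¬ J ≤ N') {G : Type u} [Group G] [Finite G] {m : M.obj G} (hm : m ∈ N.carrier G) :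
    ∃ j ∈ J.carrier G, m - j ∈ N'.carrier G := by
  rcases hs.eq_bot_or_eq_top (push N N' J) with h | h
  · refine absurd ?_ hJN
    intro H _ _ j hj
    have h1 : N.qmk N' j (hJ H hj) ∈ (push N N' J).carrier H :=
      ⟨⟨j, hJ H hj⟩, hj, rfl⟩
    rw [h H] at h1
    exact qmk_eq_zero.1 ((Submodule.mem_bot F).1 h1)
  · have h1 : N.qmk N' m hm ∈ (push N N' J).carrier G :=
      (h G).ge (Submodule.mem_top (x := (N.qmk N' m hm : (N.quot N').obj G)))
    obtain ⟨⟨j, hjN⟩, hj, hjm⟩ := h1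
    exact ⟨j, hj, (Submodule.Quotient.eq ((N'.carrier G).submoduleOf (N.carrier G))).1 hjm.symm⟩

/-- Isomorphisms of subquotients induced by inclusions. -/
theorem nonempty_quot_iso {N N' J J' : Sub M} (hJ : J ≤ N)
    (h : ∀ (G : Type u) [Group G] [Finite G], ∀ j ∈ J.carrier G,
      j ∈ J'.carrier G ↔ j ∈ N'.carrier G)
    (hN : ∀ (G : Type u) [Group G] [Finite G], ∀ m ∈ N.carrier G,
      ∃ j ∈ J.carrier G, m - j ∈ N'.carrier G) :
    Nonempty ((J.quot J').Iso (N.quot N')) := by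
  let f : ∀ (G : Type u) [Group G] [Finite G], J.QuotObj J' G →ₗ[F] N.QuotObj N' G :=
    fun G _ _ => Submodule.mapQ _ _ (Submodule.inclusion (hJ G))
      fun j hj => (h G j.1 j.2).1 hj
  have hf : ∀ (G : Type u) [Group G] [Finite G], Function.Bijective (f G) := by
    intro G _ _
    constructor
    · rw [← LinearMap.ker_eq_bot, LinearMap.ker_eq_bot']
      intro x hx
      obtain ⟨j, hj, rfl⟩ := exists_qmk x
      have hx' : N.qmk N' j (hJ G hj) = 0 := hx
      rw [qmk_eq_zero] at hx' ⊢
      exact (h G j hj).2 hx'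
    · intro x
      obtain ⟨m, hm, rfl⟩ := exists_qmk x
      obtain ⟨j, hj, hjm⟩ := hN G m hm
      refine ⟨J.qmk J' j hj, ?_⟩
      exact ((Submodule.Quotient.eq ((N'.carrier G).submoduleOf (N.carrier G))).2 hjm).symm
  refine ⟨⟨fun G _ _ => LinearEquiv.ofBijective (f G) (hf G), ?_, ?_⟩⟩
  · intro G H _ _ _ _ U x
    obtain ⟨j, hj, rfl⟩ := exists_qmk x
    rfl
  · intro G H _ _ _ _ a x
    obtain ⟨j, hj, rfl⟩ := exists_qmk x
    rfl

end Sub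

end FBKModule

/-! ## The simple subquotients of `FB_K` -/

open GrpOver
open FBKModule (Sub)

variable {F : Type v} [Field F] [CharZero F] {K : Type u} [Group K] [Finite K]

theorem GrpOver.IsBKGroup.isSimple {A : GrpOver K} (hA : A.IsBKGroup) :
    (A.simpleModule F).IsSimple where
  nonzero := by
    refine ⟨A.L, inferInstance, inferInstance, ?_⟩
    refine nontrivial_of_ne ((A.ideal F).qmk (A.ideal₀ F) _ (mem_ideal_self A)) 0 fun h => ?_
    exact not_mem_ideal₀_self A (Sub.qmk_eq_zero.1 h)
  eq_bot_or_eq_top := by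
    intro (Q : Sub ((A.ideal F).quot (A.ideal₀ F)))
    -- The preimage of `Q` either contains the generator of `e_A`, or lies in `e⁰_A` by `le_ideal₀`.
    by_cases h : (Sub.pull _ _ Q).Mem A
    · right
      intro G _ _
      rw [eq_top_iff]
      intro x _
      obtain ⟨m, hm, rfl⟩ := Sub.exists_qmk (N := A.ideal F) (N' := A.ideal₀ F) x
      exact (Sub.mem_pull.1 ((ideal_le_iff _ A).2 h G hm)).2
    · left
      intro G _ _
      rw [eq_bot_iff]
      intro x hx
      obtain ⟨m, hm, rfl⟩ := Sub.exists_qmk (N := A.ideal F) (N' := A.ideal₀ F) x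
      exact (Submodule.mem_bot F).2
        (Sub.qmk_eq_zero.2 (hA.le_ideal₀ (Sub.pull_le Q) h G (Sub.mem_pull.2 ⟨hm, hx⟩)))

/-! ### The action of idempotents as an isomorphism invariant. -/

/-- The action of an element of `F B(G × K)` on the evaluation at `G` of a module. -/
def FBKModule.act (M : FBKModule.{u, v, w} F K) {G : Type u} [Group G] [Finite G]
    (a : FB F (G × K)) (m : M.obj G) : M.obj G :=
  M.map (Biset.ofRes ((MonoidHom.id G).prod (MonoidHom.id G))) (M.mul a m)

omit [CharZero F] in
theorem FBKModule.Iso.equiv_act {M N : FBKModule.{u, v, w} F K} (e : M.Iso N) {G : Type u}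
    [Group G] [Finite G] (a : FB F (G × K)) (m : M.obj G) :
    e.equiv G (M.act a m) = N.act a (e.equiv G m) := by
  unfold FBKModule.act
  rw [e.map_equiv, e.mul_equiv]

omit [CharZero F] in
theorem act_qmk {I J : (shiftedBurnside F K).Sub} {G : Type u} [Group G] [Finite G]
    (a b : FB F (G × K)) (hb : b ∈ I.carrier G) :
    (I.quot J).act a (I.qmk J b hb) = I.qmk J (FB.prodMul a b) (Sub.prodMul_mem a hb) := by
  have h1 : ∀ (c c' : (shiftedBurnside F K).obj G) (hc : c ∈ I.carrier G) (hc' : c' ∈ I.carrier G),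
      c = c' → I.qmk J c hc = I.qmk J c' hc' := by
    rintro c _ hc hc' rfl
    rfl
  exact h1 _ _ _ _ (FB.prodMul_eq_mapK a b).symm

theorem act_gluck_qmk {I J : (shiftedBurnside F K).Sub} {G L : Type u} [Group G] [Finite G]
    [Group L] [Finite L] {f : L →* G × K} (hf : Function.Injective f)
    (b : FB F (G × K)) (hb : b ∈ I.carrier G) :
    (FB.mark f.range b = 0 → (I.quot J).act (FB.gluck F f) (I.qmk J b hb) = 0) := by
  intro h
  rw [act_qmk]
  refine Sub.qmk_eq_zero.2 ?_
  rw [FB.gluck_prodMul hf, h, zero_smul]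
  exact (J.carrier G).zero_mem

theorem act_gluck_self_ne_zero {I J : (shiftedBurnside F K).Sub} {A : GrpOver K}
    (hI : I.Mem A) (hJ : ¬ J.Mem A) :
    (I.quot J).act (FB.gluck F A.emb) (I.qmk J (FB.gluck F A.emb) hI) ≠ 0 := by
  intro h
  have h1 := Sub.qmk_eq_zero.1 ((act_qmk _ _ hI).symm.trans h)
  rw [FB.gluck_prodMul A.emb_injective] at h1
  have h2 : FB.mark A.emb.range (FB.gluck F A.emb) ≠ 0 :=
    (FB.mark_gluck_ne_zero_iff A.emb_injective).2 ⟨1, by simp⟩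
  exact hJ (((J.carrier A.L).smul_mem_iff h2).1 h1)

/-- The idempotent of `A` does not kill its own class in `S_A`, and an isomorphism commutes with
this action. Hence a representative `y` in `e_B` of the image class has non-zero mark at the graph
of `A`, which puts `A` in `e_B`. -/
theorem isQuotient_of_simpleModule_iso {A B : GrpOver K} (hB : B.IsBKGroup)
    (e : (A.simpleModule F).Iso (B.simpleModule F)) : A.IsQuotient B := by
  rw [← hB.mem_ideal_iff (F := F)]
  obtain ⟨y, hy, hxy⟩ := Sub.exists_qmk (N := B.ideal F) (N' := B.ideal₀ F)
    (e.equiv A.L ((A.ideal F).qmk (A.ideal₀ F) _ (mem_ideal_self A)))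
  refine Sub.gluck_mem_of_mark A.emb_injective hy fun h => ?_
  refine act_gluck_self_ne_zero (mem_ideal_self A) (not_mem_ideal₀_self (F := F) A) ?_
  refine (e.equiv A.L).map_eq_zero_iff.1 ?_
  refine (e.equiv_act _ _).trans ?_
  rw [← hxy]
  exact act_gluck_qmk A.emb_injective y hy h

theorem simpleModule_iso_iff {A B : GrpOver K} (hA : A.IsBKGroup) (hB : B.IsBKGroup) :
    Nonempty ((A.simpleModule F).Iso (B.simpleModule F)) ↔ Nonempty (A ≅ B) := by
  constructor
  · rintro ⟨e⟩
    exact (isQuotient_of_simpleModule_iso hB e).antisymm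
      (isQuotient_of_simpleModule_iso hA e.symm)
  · rintro ⟨e⟩
    have hAB := isQuotient_of_iso e
    have hBA := isQuotient_of_iso e.symm
    have h₀ : ∀ {A B : GrpOver K}, (A ≅ B) → A.ideal₀ F ≤ B.ideal₀ F := by
      intro A B e
      refine Sub.le_iff.2 fun D hD => ?_
      obtain ⟨C, ⟨hC, hCA, hn⟩, hDC⟩ := (mem_ideal₀_iff A D).1 hD
      refine (mem_ideal₀_iff B D).2 ⟨C, ⟨hC, hCA.trans (isQuotient_of_iso e), ?_⟩, hDC⟩
      rintro ⟨e'⟩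
      exact hn ⟨e'.trans e.symm⟩
    refine Sub.nonempty_quot_iso ((ideal_le_iff _ A).2 ((hB.mem_ideal_iff A).2 hAB)) ?_ ?_
    · intro G _ _ j _
      exact ⟨fun hj => h₀ e G hj, fun hj => h₀ e.symm G hj⟩
    · intro G _ _ m hm
      refine ⟨m, (ideal_le_iff _ B).2 ((hA.mem_ideal_iff B).2 hBA) G hm, ?_⟩
      rw [sub_self]
      exact Submodule.zero_mem _

theorem exists_simpleModule_iso {I I' : (shiftedBurnside F K).Sub} (hs : (I.quot I').IsSimple) :
    ∃ A : GrpOver K, A.IsBKGroup ∧ Nonempty ((I.quot I').Iso (A.simpleModule F)) := by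
  have hnle : ¬ I ≤ I' := by
    intro hle
    obtain ⟨G, _, _, ⟨x, y, hxy⟩⟩ := hs.nonzero
    have h0 : ∀ x : I.QuotObj I' G, x = 0 := by
      intro x
      obtain ⟨m, hm, rfl⟩ := Sub.exists_qmk x
      exact Sub.qmk_eq_zero.2 (hle G hm)
    exact hxy ((h0 x).trans (h0 y).symm)
  rw [Sub.le_iff] at hnle
  push Not at hnle
  obtain ⟨B, hB, hB'⟩ := hnle
  obtain ⟨A, hA, hBA, hP⟩ := B.exists_isBKGroup
  have hAI : I.Mem A := hP _ I.closed_mem hB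
  have hAI' : ¬ I'.Mem A := fun h => hB' (I'.closed_mem.of_isQuotient hBA h)
  have hle : A.ideal F ≤ I := (ideal_le_iff I A).2 hAI
  -- If a `B_K`-group `C` strictly above `A` were missing from `I'`, simplicity would give `I = e_C
  -- + I'`, and the idempotent of `A` could be split accordingly.
  have hle₀ : A.ideal₀ F ≤ I' := by
    refine Sub.le_iff.2 fun D hD => ?_
    obtain ⟨C, ⟨hC, hCA, hn⟩, hDC⟩ := (mem_ideal₀_iff A D).1 hD
    refine I'.closed_mem.of_isQuotient hDC ?_
    by_contra hCI'
    have hCI : I.Mem C := I.closed_mem.of_isQuotient hCA hAI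
    obtain ⟨j, hj, hj'⟩ := Sub.exists_sub_mem_of_isSimple hs ((ideal_le_iff I C).2 hCI)
      (fun h => hCI' ((ideal_le_iff I' C).1 h)) hAI
    -- A non-zero mark would put `A` in `e_C`, making `A` and `C` isomorphic. So the component in
    -- `I'` carries the whole mark at `A`, and then `A` would lie in `I'`.
    have h1 : FB.mark A.emb.range (show FB F (A.L × K) from j) = 0 := by
      by_contra h
      exact hn (hCA.antisymm
        ((hC.mem_ideal_iff A).1 (Sub.gluck_mem_of_mark A.emb_injective hj h)))
    refine hAI' (Sub.gluck_mem_of_mark A.emb_injective hj' ?_)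
    refine (map_sub (FB.mark A.emb.range) (FB.gluck F A.emb) j).trans_ne ?_
    refine (congrArg (fun c => _ - c) h1).trans_ne ?_
    rw [sub_zero]
    exact (FB.mark_gluck_ne_zero_iff A.emb_injective).2 ⟨1, by simp⟩
  -- The intersection of `e_A` and `I'` misses `A`, so it lies in `e⁰_A`; with the previous
  -- inclusion, `e⁰_A` and `I'` agree on `e_A`.
  let J : (shiftedBurnside F K).Sub :=
    { carrier := fun G _ _ => (A.ideal F).carrier G ⊓ I'.carrier G
      map_mem := fun U _ h => ⟨(A.ideal F).map_mem U h.1, I'.map_mem U h.2⟩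
      mul_mem := fun a _ h => ⟨(A.ideal F).mul_mem a h.1, I'.mul_mem a h.2⟩ }
  have hJ : J ≤ A.ideal₀ F := hA.le_ideal₀ (fun G _ _ m hm => hm.1) fun h => hAI' h.2
  obtain ⟨e⟩ := Sub.nonempty_quot_iso (J' := A.ideal₀ F) hle
    (fun G _ _ j hj => ⟨fun h => hle₀ G h, fun h => hJ G ⟨hj, h⟩⟩)
    (fun G _ _ m hm => Sub.exists_sub_mem_of_isSimple hs hle
      (fun h => hAI' ((ideal_le_iff I' A).1 h)) hm)
  exact ⟨A, hA, ⟨e.symm⟩⟩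

end
end RelBGroup

theorem mainTheorem4 (F : Type v) [Field F] [CharZero F] (K : Type u) [Group K] [Finite K] :
    (∀ A : RelBGroup.GrpOver K, A.IsBKGroup →
      A.ideal₀ F ≤ A.ideal F ∧ (A.simpleModule F).IsSimple) ∧
    (∀ A B : RelBGroup.GrpOver K, A.IsBKGroup → B.IsBKGroup →
      (Nonempty ((A.simpleModule F).Iso (B.simpleModule F)) ↔
        Nonempty (CategoryTheory.Iso A B))) ∧
    (∀ I I' : (RelBGroup.shiftedBurnside F K).Sub, I' ≤ I → (I.quot I').IsSimple →
      ∃ A : RelBGroup.GrpOver K, A.IsBKGroup ∧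
        Nonempty ((I.quot I').Iso (A.simpleModule F)) ∧
        ∀ B : RelBGroup.GrpOver K, B.IsBKGroup →
          Nonempty ((I.quot I').Iso (B.simpleModule F)) →
            Nonempty (CategoryTheory.Iso B A)) := by
  refine ⟨fun A hA => ⟨hA.ideal₀_le, hA.isSimple⟩,
    fun A B hA hB => RelBGroup.simpleModule_iso_iff hA hB, fun I I' _ hs => ?_⟩
  obtain ⟨A, hA, ⟨e⟩⟩ := RelBGroup.exists_simpleModule_iso hs
  exact ⟨A, hA, ⟨e⟩, fun B hB ⟨e'⟩ =>
    (RelBGroup.simpleModule_iso_iff hB hA).1 ⟨e'.symm.trans e⟩⟩
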